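/- Let $\mathcal A$ be a finite set of (affine) hyperplanes in $\mathbb C^{\ell}$, let $H\in\mathcal A$, put $\mathcal A'=\mathcal A\setminus\{H\}$, and let $\mathcal A''$ be the arrangement in $H$ that consists of the nonempty intersections $K\cap H$, $K\in\mathcal A'$. Let $$M=\mathbb C^{\ell}\setminus\bigcup_{K\in\mathcal A}K,\qquad M'=\mathbb C^{\ell}\setminus\bigcup_{K\in\mathcal A'}K,\qquad M''=H\setminus\bigcup_{K\in\mathcal A''}K=M'\cap H$$ be the complements, and let $i:M\to M'$ and $j:M''\to M'$ be the inclusions. Let $\mathcal L'$ be a complex local system of rank one on $M'$, and let $\mathcal L=i^{*}\mathcal L'$ and $\mathcal L''=j^{*}\mathcal L'$ be the induced local systems on $M$ and $M''$. Cohomology is cohomology with local coefficients, and it is zero in negative degrees. 1. For every integer $q$, if $H^{q-1}(M'';\mathcal L'')=0$ and $H^{q}(M;\mathcal L)\neq 0$, then $H^{q}(M';\mathcal L')\neq 0$. 2. If $\mathcal L''$ is non-trivial (not isomorphic to the constant local system $\mathbb C$), then the restriction map $i^{*}:H^{1}(M';\mathcal L')\to H^{1}(M;\mathcal L)$ is an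 isomorphism. -/

import Mathlib

open CategoryTheory

noncomputable section

/-! ### Local systems -/

/-- A local system of complex vector spaces on `X`: a functor from the fundamental groupoid
of `X` to complex vector spaces.  It assigns to each point of `X` a fibre and to each homotopy
class of paths (with fixed ends) the parallel transport between the fibres at its ends. -/
abbrev LocalSystem (X : Type) [TopologicalSpace X] :=
  FundamentalGroupoid X ⥤ ModuleCat.{0} ℂ

namespace LocalSystem

variable {X Y : Type} [TopologicalSpace X] [TopologicalSpace Y]

/-- A local system has rank one if all its fibres are one-dimensional. -/
def IsRankOne (L : LocalSystem X) : Prop :=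
  ∀ x : FundamentalGroupoid X, Module.finrank ℂ (L.obj x) = 1

/-- A rank one local system is trivial if it is isomorphic to the constant local system with
fibre `ℂ`. -/
def IsTrivial (L : LocalSystem X) : Prop :=
  Nonempty (L ≅ (Functor.const (FundamentalGroupoid X)).obj (ModuleCat.of ℂ ℂ))

/-- The inverse image `f^* L` of a local system under a continuous map. -/
abbrev pullback (f : C(X, Y)) (L : LocalSystem Y) : LocalSystem X :=
  FundamentalGroupoid.map f ⋙ L

end LocalSystem

/-! ### Singular simplices -/

/-- The standard topological `n`-simplex. -/
abbrev TopSimplex (n : SimplexCategory) : Type := stdSimplex ℝ (Fin (n.len + 1))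

namespace TopSimplex

/-- The affine map of standard simplices induced by a monotone map of vertices. -/
def map {n m : SimplexCategory} (θ : n ⟶ m) : C(TopSimplex n, TopSimplex m) :=
  ⟨stdSimplex.map θ, stdSimplex.continuous_map θ⟩

/-- The initial vertex of the standard simplex. -/
def base (n : SimplexCategory) : TopSimplex n := stdSimplex.vertex 0

/-- The straight path `t ↦ (1 - t) a + t b` in the standard simplex. -/
def segment {n : SimplexCategory} (a b : TopSimplex n) : Path a b where
  toFun t := ⟨(1 - (t : ℝ)) • (a : Fin (n.len + 1) → ℝ) + (t : ℝ) • (b : Fin (n.len + 1) → ℝ),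
    convex_stdSimplex ℝ _ a.2 b.2 (sub_nonneg.2 t.2.2) t.2.1 (by ring)⟩
  continuous_toFun := by fun_prop
  source' := Subtype.ext (by simp; rfl)
  target' := Subtype.ext (by simp; rfl)

/-- The class of the straight path in the fundamental groupoid of the standard simplex. -/
def segmentHom {n : SimplexCategory} (a b : TopSimplex n) :
    FundamentalGroupoid.mk a ⟶ FundamentalGroupoid.mk b :=
  FundamentalGroupoid.fromPath (Path.Homotopic.Quotient.mk (segment a b))

instance (n : SimplexCategory) : ContractibleSpace (TopSimplex n) :=
  (convex_stdSimplex ℝ (Fin (n.len + 1))).contractibleSpace ⟨_, (base n).2⟩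

/-- In the simplex all paths with the same ends are homotopic. -/
theorem hom_eq {n : SimplexCategory} {a b : FundamentalGroupoid (TopSimplex n)} (p q : a ⟶ b) :
    p = q :=
  Subsingleton.elim (α := Path.Homotopic.Quotient a.as b.as) p q

theorem map_id (n : SimplexCategory) : map (𝟙 n) = ContinuousMap.id _ := by
  ext1 x
  exact stdSimplex.map_id_apply x

theorem map_comp {n m k : SimplexCategory} (θ : n ⟶ m) (η : m ⟶ k) :
    map (θ ≫ η) = (map η).comp (map θ) := by
  ext1 x
  exact (stdSimplex.map_comp_apply (S := ℝ) (⇑θ) (⇑η) x).symm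

end TopSimplex

/-! ### Singular cohomology with local coefficients -/

namespace LocalSystem

variable {X Y : Type} [TopologicalSpace X] [TopologicalSpace Y]

/-- Singular `n`-cochains with coefficients in `L`: a cochain assigns to each singular simplex
`σ : Δⁿ → X` an element of the fibre of `L` at the image of the initial vertex. -/
abbrev Cochain (L : LocalSystem X) (n : SimplexCategory) : Type :=
  ∀ σ : C(TopSimplex n, X), L.obj ⟨σ (TopSimplex.base n)⟩

/-- Parallel transport in `L` along the image under `σ` of the straight path from `a` to `b`. -/
def transport (L : LocalSystem X) {n : SimplexCategory} (σ : C(TopSimplex n, X))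
    (a b : TopSimplex n) : L.obj ⟨σ a⟩ ⟶ L.obj ⟨σ b⟩ :=
  L.map ((FundamentalGroupoid.map σ).map (TopSimplex.segmentHom a b))

/-- The operator on cochains induced by `θ : [n] → [m]`: the value of `θ_* c` at `σ` is the value
of `c` at the simplex `σ ∘ θ`, transported inside the simplex `σ` from the fibre over the initial
vertex of `σ ∘ θ` to the fibre over the initial vertex of `σ`. -/
def cochainMap (L : LocalSystem X) {n m : SimplexCategory} (θ : n ⟶ m) :
    Cochain L n →ₗ[ℂ] Cochain L m :=
  LinearMap.pi fun σ =>
    (transport L σ (TopSimplex.map θ (TopSimplex.base n)) (TopSimplex.base m)).hom ∘ₗ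
      LinearMap.proj (R := ℂ) (φ := fun τ : C(TopSimplex n, X) =>
        (L.obj ⟨τ (TopSimplex.base n)⟩ : Type)) (σ.comp (TopSimplex.map θ))

theorem cochainMap_apply (L : LocalSystem X) {n m : SimplexCategory} (θ : n ⟶ m)
    (c : Cochain L n) (σ : C(TopSimplex m, X)) :
    cochainMap L θ c σ =
      (transport L σ (TopSimplex.map θ (TopSimplex.base n)) (TopSimplex.base m)).hom
        (c (σ.comp (TopSimplex.map θ))) := rfl

/-- A value of a cochain, transported along any path inside a simplex, depends only on the
restricted simplex. -/
theorem transport_congr (L : LocalSystem X) {n m : SimplexCategory} (c : Cochain L n)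
    (σ : C(TopSimplex m, X)) {φ ψ : C(TopSimplex n, TopSimplex m)} (h : φ = ψ) {b : TopSimplex m}
    (p : FundamentalGroupoid.mk (φ (TopSimplex.base n)) ⟶ ⟨b⟩)
    (q : FundamentalGroupoid.mk (ψ (TopSimplex.base n)) ⟶ ⟨b⟩) :
    (L.map ((FundamentalGroupoid.map σ).map p)).hom (c (σ.comp φ)) =
      (L.map ((FundamentalGroupoid.map σ).map q)).hom (c (σ.comp ψ)) := by
  subst h
  rw [TopSimplex.hom_eq p q]

theorem cochainMap_id (L : LocalSystem X) (n : SimplexCategory) (c : Cochain L n) :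
    cochainMap L (𝟙 n) c = c := by
  funext σ
  refine (transport_congr L c σ (TopSimplex.map_id n) _ (𝟙 _)).trans ?_
  rw [CategoryTheory.Functor.map_id, CategoryTheory.Functor.map_id]
  rfl

theorem transport_trans (L : LocalSystem X) {n : SimplexCategory} (σ : C(TopSimplex n, X))
    (a b d : TopSimplex n) : transport L σ a b ≫ transport L σ b d = transport L σ a d :=
  ((FundamentalGroupoid.map σ ⋙ L).map_comp (TopSimplex.segmentHom a b)
    (TopSimplex.segmentHom b d)).symm.trans
      (congrArg (FundamentalGroupoid.map σ ⋙ L).map (TopSimplex.hom_eq _ _))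

theorem transport_comp (L : LocalSystem X) {n m : SimplexCategory} (σ : C(TopSimplex m, X))
    (φ : C(TopSimplex n, TopSimplex m)) (a b : TopSimplex n) :
    transport L (σ.comp φ) a b = transport L σ (φ a) (φ b) :=
  congrArg (fun p : FundamentalGroupoid.mk (φ a) ⟶ FundamentalGroupoid.mk (φ b) =>
      L.map ((FundamentalGroupoid.map σ).map p))
    (TopSimplex.hom_eq ((FundamentalGroupoid.map φ).map (TopSimplex.segmentHom a b)) _)

theorem cochainMap_comp (L : LocalSystem X) {n m k : SimplexCategory} (θ : n ⟶ m) (η : m ⟶ k)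
    (c : Cochain L n) : cochainMap L (θ ≫ η) c = cochainMap L η (cochainMap L θ c) := by
  funext σ
  refine (transport_congr L c σ (TopSimplex.map_comp θ η) _
    (TopSimplex.segmentHom (TopSimplex.map η (TopSimplex.map θ (TopSimplex.base n)))
      (TopSimplex.base k))).trans ?_
  have h1 := transport_comp L σ (TopSimplex.map η) (TopSimplex.map θ (TopSimplex.base n))
    (TopSimplex.base m)
  have h2 := transport_trans L σ (TopSimplex.map η (TopSimplex.map θ (TopSimplex.base n)))
    (TopSimplex.map η (TopSimplex.base m)) (TopSimplex.base k)
  rw [← h1] at h2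
  exact (LinearMap.congr_fun (congrArg ModuleCat.Hom.hom h2) _).symm

/-- The cosimplicial vector space of singular cochains of `X` with coefficients in `L`. -/
def cosimplicialCochains (L : LocalSystem X) : CosimplicialObject (ModuleCat.{0} ℂ) where
  obj n := ModuleCat.of ℂ (Cochain L n)
  map θ := ModuleCat.ofHom (cochainMap L θ)
  map_id n := by
    ext c σ
    exact congrFun (cochainMap_id L n c) σ
  map_comp θ η := by
    ext c σ
    exact congrFun (cochainMap_comp L θ η c) σ

/-- The singular cochain complex of `X` with coefficients in `L`, with differential
`∑ i, (-1)^i δ^i`, where `δ^i` is restriction to the `i`-th face (followed by transport to the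
fibre over the initial vertex). -/
def cochainComplex (L : LocalSystem X) : CochainComplex (ModuleCat.{0} ℂ) ℕ :=
  (AlgebraicTopology.alternatingCofaceMapComplex (ModuleCat.{0} ℂ)).obj (cosimplicialCochains L)

/-- The cohomology `H^q(X; L)`, for every integer `q`; it is zero for negative `q`. -/
def cohomology (L : LocalSystem X) : ℤ → ModuleCat.{0} ℂ
  | Int.ofNat q => (cochainComplex L).homology q
  | Int.negSucc _ => ModuleCat.of ℂ PUnit

/-- The restriction of cochains along `f : X → Y`, namely `(f^* c)(σ) = c (f ∘ σ)`. -/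
def cosimplicialRestriction (f : C(X, Y)) (L : LocalSystem Y) :
    cosimplicialCochains L ⟶ cosimplicialCochains (L.pullback f) where
  app n := ModuleCat.ofHom
    { toFun := fun (c : Cochain L n) σ => c (f.comp σ)
      map_add' := fun _ _ => rfl
      map_smul' := fun _ _ => rfl }
  naturality n m θ := by
    ext c
    rfl

/-- The map of cochain complexes induced by `f : X → Y`. -/
def cochainRestriction (f : C(X, Y)) (L : LocalSystem Y) :
    cochainComplex L ⟶ cochainComplex (L.pullback f) :=
  (AlgebraicTopology.alternatingCofaceMapComplex (ModuleCat.{0} ℂ)).map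
    (cosimplicialRestriction f L)

/-- The restriction map `f^* : H^q(Y; L) → H^q(X; f^* L)`. -/
def restriction (f : C(X, Y)) (L : LocalSystem Y) :
    (q : ℤ) → (L.cohomology q ⟶ (L.pullback f).cohomology q)
  | Int.ofNat q => HomologicalComplex.homologyMap (cochainRestriction f L) q
  | Int.negSucc _ => 𝟙 _

end LocalSystem

/-! ### Hyperplane arrangements -/

/-- A hyperplane of a complex affine space: a nonempty affine subspace of codimension one. -/
structure IsHyperplane {V P : Type} [AddCommGroup V] [Module ℂ V] [AddTorsor V P]
    (K : AffineSubspace ℂ P) : Prop where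
  nonempty : (K : Set P).Nonempty
  codim_one : Module.finrank ℂ (V ⧸ K.direction) = 1

/-- An arrangement of (affine) hyperplanes: a finite set of hyperplanes of an affine space. -/
structure HyperplaneArrangement (V P : Type) [AddCommGroup V] [Module ℂ V] [AddTorsor V P] where
  hyperplanes : Set (AffineSubspace ℂ P)
  finite : hyperplanes.Finite
  isHyperplane : ∀ K ∈ hyperplanes, IsHyperplane K

/-- The trace on a hyperplane `H` of another hyperplane `K` is a hyperplane of `H`, unless it is
empty. -/
theorem IsHyperplane.comap_subtype {V P : Type} [AddCommGroup V] [Module ℂ V] [AddTorsor V P]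
    {H K : AffineSubspace ℂ P} [Nonempty H] (hH : IsHyperplane H) (hK : IsHyperplane K)
    (hne : K ≠ H) (h : (K.comap H.subtype : Set H).Nonempty) :
    IsHyperplane (K.comap H.subtype) := by
  refine ⟨h, ?_⟩
  obtain ⟨x, hx⟩ := h
  have hxK : (x : P) ∈ K := hx
  let φ : H.direction →ₗ[ℂ] V ⧸ K.direction := K.direction.mkQ ∘ₗ H.direction.subtype
  have hker : LinearMap.ker φ = (K.comap H.subtype).direction := by
    ext v
    have h1 : v ∈ LinearMap.ker φ ↔ (v : V) ∈ K.direction := by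
      simp [φ, Submodule.Quotient.mk_eq_zero]
    rw [h1, ← AffineSubspace.vadd_mem_iff_mem_direction (v : V) hxK,
      ← AffineSubspace.vadd_mem_iff_mem_direction v hx]
    rfl
  have : FiniteDimensional ℂ (V ⧸ K.direction) :=
    FiniteDimensional.of_finrank_eq_succ hK.codim_one
  have : FiniteDimensional ℂ (V ⧸ H.direction) :=
    FiniteDimensional.of_finrank_eq_succ hH.codim_one
  have hsurj : LinearMap.range φ = ⊤ := by
    by_contra hr
    have hlt := Submodule.finrank_lt hr
    rw [hK.codim_one, Nat.lt_one_iff, Submodule.finrank_eq_zero, LinearMap.range_eq_bot] at hlt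
    have hle : H.direction ≤ K.direction := fun v hv => by
      have := LinearMap.congr_fun hlt ⟨v, hv⟩
      simpa [φ, Submodule.Quotient.mk_eq_zero] using this
    have hinj : Function.Injective (Submodule.factor hle) :=
      (LinearMap.injective_iff_surjective_of_finrank_eq_finrank
        (hH.codim_one.trans hK.codim_one.symm)).2 (Submodule.factor_surjective hle)
    have hge : K.direction ≤ H.direction := fun v hv => by
      rw [← Submodule.Quotient.mk_eq_zero] at hv ⊢
      apply hinj
      simpa using hv
    exact hne (AffineSubspace.ext_of_direction_eq (le_antisymm hge hle) ⟨x, hxK, x.2⟩)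
  rw [← hker, (φ.quotKerEquivRange).finrank_eq, hsurj, finrank_top, hK.codim_one]

namespace HyperplaneArrangement

variable {V P : Type} [AddCommGroup V] [Module ℂ V] [AddTorsor V P]

/-- The complement `M(A)` of the union of the hyperplanes of `A`. -/
def complement (A : HyperplaneArrangement V P) : Set P :=
  {x | ∀ K ∈ A.hyperplanes, x ∉ K}

/-- The deletion `A' = A \ {H}`. -/
def deletion (A : HyperplaneArrangement V P) (H : A.hyperplanes) : HyperplaneArrangement V P where
  hyperplanes := A.hyperplanes \ {(H : AffineSubspace ℂ P)}
  finite := A.finite.subset Set.sdiff_subset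
  isHyperplane K hK := A.isHyperplane K hK.1

instance (A : HyperplaneArrangement V P) (H : A.hyperplanes) :
    Nonempty (H : AffineSubspace ℂ P) :=
  (A.isHyperplane H H.2).nonempty.to_subtype

/-- The restriction `A''` of `A` to `H`: the arrangement in the affine space `H` that consists of
the (nonempty) intersections `K ∩ H`, where `K` runs through `A \ {H}`. -/
def restriction (A : HyperplaneArrangement V P) (H : A.hyperplanes) :
    HyperplaneArrangement (H : AffineSubspace ℂ P).direction (H : AffineSubspace ℂ P) where
  hyperplanes := {T | (T : Set (H : AffineSubspace ℂ P)).Nonempty ∧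
    ∃ K ∈ (A.deletion H).hyperplanes, T = K.comap (H : AffineSubspace ℂ P).subtype}
  finite := ((A.deletion H).finite.image
    fun K => K.comap (H : AffineSubspace ℂ P).subtype).subset (by
      rintro T ⟨-, K, hK, rfl⟩
      exact ⟨K, hK, rfl⟩)
  isHyperplane := by
    rintro T ⟨hT, K, hK, rfl⟩
    exact (A.isHyperplane H H.2).comap_subtype (A.isHyperplane K hK.1) hK.2 hT

variable [TopologicalSpace P]

/-- The inclusion `i : M → M'` of the complement of `A` in the complement of `A'`. -/
def inclDeletion (A : HyperplaneArrangement V P) (H : A.hyperplanes) :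
    C(A.complement, (A.deletion H).complement) where
  toFun x := ⟨x, fun K hK => x.2 K hK.1⟩
  continuous_toFun := by fun_prop

/-- The inclusion `j : M'' → M'` of the complement of `A''` in the complement of `A'`. -/
def inclRestriction (A : HyperplaneArrangement V P) (H : A.hyperplanes) :
    C((A.restriction H).complement, (A.deletion H).complement) where
  toFun x := ⟨((x : (H : AffineSubspace ℂ P)) : P), fun K hK hx =>
    x.2 (K.comap (H : AffineSubspace ℂ P).subtype) ⟨⟨(x : (H : AffineSubspace ℂ P)), hx⟩,
      K, hK, rfl⟩ hx⟩
  continuous_toFun := by fun_prop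

end HyperplaneArrangement

end

/-! Write Z for M'' as a closed subset of M', so that M is its complement. Around Z lies a tube N, a
family of open discs (possibly of infinite radius) parallel to a vector transverse to H. Cutting the
discs along the negative or the positive real axis of the transverse coordinate gives sectors U and
V with U ∪ V = N ∖ Z, and U ∩ V is the disjoint union of half-discs W₁ and W₂. The tube deforms into
each of Z, U, V, W₁, W₂. These deformations and Mayer–Vietoris replace the Thom isomorphism and the
exact sequence H^q(M') → H^q(M) → H^{q-1}(M'').

Surjectivity: a cocycle on N ∖ Z agrees on U, up to a coboundary, with a cocycle on N. The
difference is a coboundary on V as well, since V, N and W₁ have the same cohomology and W₁ ⊆ U. The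
remaining Mayer–Vietoris obstruction lies in the cohomology of W₁ ⊔ W₂ one degree lower, that is in
two copies of that of Z (`IsTube.exists_cocyc_nbhd`). If it vanishes, a cocycle on M can be glued
with one on N (`IsTube.exists_cocyc_univ`). This gives part 1. In part 2 it gives surjectivity,
because M'' is path connected and a non-trivial rank one system on it has no sections
(`cocyc_zero_le_cob`).

Injectivity in degree one needs no vanishing: the obstruction for M' = M ∪ N lies in H^0(N ∖ Z), and
H^0(N) maps onto this group, as nothing lives in degree -1 (`IsTube.mem_cob_univ`).

All of this takes place in the cochain spaces of the single system L' on M'. Being a cocycle or a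
coboundary on a subset A is a condition on the simplices in A only, so no restricted system is
needed until the end. Mayer–Vietoris rests on small simplices (`exists_d_eq_of_small`), obtained
from formal chains of tuples in a convex set. Such chains are paired with twisted cochains by
transport to one fibre, where Stokes' formula `pair_d` holds. -/

noncomputable section

/-! ### Chains of tuples -/

/-- Formal linear combinations of `k`-tuples of elements of `E`. -/
abbrev TupleChain (E : Type) (k : ℕ) : Type := (Fin k → E) →₀ ℂ

namespace TupleChain

variable {E E' E'' : Type}

/-- The chain consisting of a single tuple. -/
abbrev of {k : ℕ} (v : Fin k → E) : TupleChain E k := Finsupp.single v 1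

/-- Put `a` in front of a tuple. -/
abbrev cons {k : ℕ} (a : E) (v : Fin k → E) : Fin (k + 1) → E := Fin.cons (α := fun _ => E) a v

/-- The map of chains induced by a map of vertices. -/
def map (φ : E → E') (k : ℕ) : TupleChain E k →ₗ[ℂ] TupleChain E' k :=
  Finsupp.lmapDomain ℂ ℂ fun v => φ ∘ v

/-- The join of a vertex with a chain. -/
def join (a : E) (k : ℕ) : TupleChain E k →ₗ[ℂ] TupleChain E (k + 1) :=
  Finsupp.lmapDomain ℂ ℂ (cons a)

/-- The boundary, with the augmentation in the lowest degree. -/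
def boundary (k : ℕ) : TupleChain E (k + 1) →ₗ[ℂ] TupleChain E k :=
  ∑ i : Fin (k + 1), ((-1 : ℂ) ^ (i : ℕ)) • Finsupp.lmapDomain ℂ ℂ fun v => v ∘ i.succAbove

@[simp] theorem map_of (φ : E → E') {k : ℕ} (v : Fin k → E) : map φ k (of v) = of (φ ∘ v) := by
  simp [map]

@[simp] theorem join_of (a : E) {k : ℕ} (v : Fin k → E) : join a k (of v) = of (cons a v) := by
  simp [join]

theorem boundary_of {k : ℕ} (v : Fin (k + 1) → E) :
    boundary k (of v) = ∑ i : Fin (k + 1), ((-1 : ℂ) ^ (i : ℕ)) • of (v ∘ i.succAbove) := by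
  simp [boundary]

theorem hom_ext {k : ℕ} {M : Type*} [AddCommGroup M] [Module ℂ M] {f g : TupleChain E k →ₗ[ℂ] M}
    (h : ∀ v, f (of v) = g (of v)) : f = g :=
  Finsupp.lhom_ext' fun v => LinearMap.ext_ring (h v)

/-- Every nonempty tuple is a join of its first entry with the rest. Inductions on the length can
thus use the cone formula and avoid signs and face indices. -/
theorem hom_ext_join {k : ℕ} {M : Type*} [AddCommGroup M] [Module ℂ M]
    {f g : TupleChain E (k + 1) →ₗ[ℂ] M} (h : ∀ a v, f (join a k (of v)) = g (join a k (of v))) :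
    f = g :=
  hom_ext fun v => by
    have := h (v 0) (Fin.tail v)
    rwa [join_of, cons, Fin.cons_self_tail] at this

theorem map_join (φ : E → E') (a : E) {k : ℕ} (z : TupleChain E k) :
    map φ (k + 1) (join a k z) = join (φ a) k (map φ k z) := by
  refine LinearMap.congr_fun (f := map φ (k + 1) ∘ₗ join a k) (g := join (φ a) k ∘ₗ map φ k)
    (hom_ext fun v => ?_) z
  simp only [LinearMap.comp_apply, join_of, map_of]
  congr 1
  funext j
  refine Fin.cases ?_ (fun j => ?_) j <;> simp

theorem map_map (φ : E → E') (ψ : E' → E'') {k : ℕ} (z : TupleChain E k) :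
    map ψ k (map φ k z) = map (ψ ∘ φ) k z := by
  refine LinearMap.congr_fun (f := map ψ k ∘ₗ map φ k) (g := map (ψ ∘ φ) k)
    (hom_ext fun v => ?_) z
  simp [Function.comp_assoc]

theorem map_id {k : ℕ} (z : TupleChain E k) : map id k z = z :=
  LinearMap.congr_fun (f := map id k) (g := LinearMap.id) (hom_ext fun v => by simp) z

theorem boundary_map (φ : E → E') {k : ℕ} (z : TupleChain E (k + 1)) :
    boundary k (map φ (k + 1) z) = map φ k (boundary k z) := by
  refine LinearMap.congr_fun (f := boundary k ∘ₗ map φ (k + 1)) (g := map φ k ∘ₗ boundary k)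
    (hom_ext fun v => ?_) z
  simp only [LinearMap.comp_apply, map_of, boundary_of, map_sum, LinearMap.map_smul]
  rfl

/-- The face opposite the apex is `z`; every other face is the cone over a face of `z`, with the
sign shifted by one. -/
theorem boundary_join (a : E) {k : ℕ} (z : TupleChain E (k + 1)) :
    boundary (k + 1) (join a (k + 1) z) = z - join a k (boundary k z) := by
  refine LinearMap.congr_fun (f := boundary (k + 1) ∘ₗ join a (k + 1))
    (g := LinearMap.id - join a k ∘ₗ boundary k) (hom_ext fun v => ?_) z
  simp only [LinearMap.comp_apply, LinearMap.sub_apply, LinearMap.id_apply, join_of, boundary_of,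
    map_sum, LinearMap.map_smul]
  rw [Fin.sum_univ_succ, sub_eq_add_neg, ← Finset.sum_neg_distrib]
  congr 1
  · simp only [Fin.val_zero, pow_zero, one_smul]
    congr 1
  · refine Finset.sum_congr rfl fun i _ => ?_
    have : cons a v ∘ i.succ.succAbove = cons a (v ∘ i.succAbove) := by
      funext j
      refine Fin.cases ?_ (fun j => ?_) j <;> simp
    rw [this, Fin.val_succ, pow_succ, mul_neg_one, neg_smul]

theorem boundary_join_zero (a : E) (z : TupleChain E 0) : boundary 0 (join a 0 z) = z := by
  refine LinearMap.congr_fun (f := boundary 0 ∘ₗ join a 0) (g := LinearMap.id)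
    (hom_ext fun v => ?_) z
  simp only [LinearMap.comp_apply, LinearMap.id_apply, join_of, boundary_of]
  rw [Fin.sum_univ_succ, Fin.sum_univ_zero]
  simp only [Fin.val_zero, pow_zero, one_smul, add_zero]
  congr 1

/-- On a cone, ∂∂(a * z) = ∂z - ∂(a * ∂z) = a * ∂∂z, which vanishes by induction. -/
theorem boundary_boundary {k : ℕ} (z : TupleChain E (k + 2)) :
    boundary k (boundary (k + 1) z) = 0 := by
  induction k with
  | zero =>
    refine LinearMap.congr_fun (f := boundary 0 ∘ₗ boundary 1) (g := 0)
      (hom_ext_join fun a v => ?_) z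
    simp [boundary_join, boundary_join_zero, -join_of]
  | succ k ih =>
    refine LinearMap.congr_fun (f := boundary (k + 1) ∘ₗ boundary (k + 2)) (g := 0)
      (hom_ext_join fun a v => ?_) z
    simp [boundary_join, ih, -join_of]

/-! ### The prism operator -/

/-- The prism operator between the maps induced by `f` and `g`. -/
def prism (f g : E → E') : (k : ℕ) → TupleChain E k →ₗ[ℂ] TupleChain E' (k + 1)
  | 0 => 0
  -- The recursion is P(a * z) = f(a) * (g(a) * g(z) - P(z)). With P = 0 on the empty tuple it
  -- produces the usual signs of the prism decomposition.
  | k + 1 => Finsupp.linearCombination ℂ fun v =>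
      join (f (v 0)) (k + 1) (join (g (v 0)) k (of (g ∘ Fin.tail v))) -
        join (f (v 0)) (k + 1) (prism f g k (of (Fin.tail v)))

theorem prism_join (f g : E → E') (a : E) {k : ℕ} (z : TupleChain E k) :
    prism f g (k + 1) (join a k z) =
      join (f a) (k + 1) (join (g a) k (map g k z)) - join (f a) (k + 1) (prism f g k z) := by
  refine LinearMap.congr_fun (f := prism f g (k + 1) ∘ₗ join a k)
    (g := join (f a) (k + 1) ∘ₗ join (g a) k ∘ₗ map g k - join (f a) (k + 1) ∘ₗ prism f g k)
    (hom_ext fun v => ?_) z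
  simp [prism]

/-- Both sides are expanded on a cone with the cone formula. In the lowest degree the images of the
empty tuple under `f` and `g` coincide. -/
theorem boundary_prism (f g : E → E') {k : ℕ} (z : TupleChain E (k + 1)) :
    boundary (k + 1) (prism f g (k + 1) z) =
      map g (k + 1) z - map f (k + 1) z - prism f g k (boundary k z) := by
  induction k with
  | zero =>
    refine LinearMap.congr_fun (f := boundary 1 ∘ₗ prism f g 1)
      (g := map g 1 - map f 1 - prism f g 0 ∘ₗ boundary 0)
      (hom_ext_join fun a v => ?_) z
    simp only [LinearMap.comp_apply, LinearMap.sub_apply, prism_join, map_sub, boundary_join,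
      boundary_join_zero, map_join]
    simp [prism, -join_of]
    rw [Subsingleton.elim (g ∘ v) (f ∘ v)]
  | succ k ih =>
    refine LinearMap.congr_fun (f := boundary (k + 2) ∘ₗ prism f g (k + 2))
      (g := map g (k + 2) - map f (k + 2) - prism f g (k + 1) ∘ₗ boundary (k + 1))
      (hom_ext_join fun a v => ?_) z
    simp only [LinearMap.comp_apply, LinearMap.sub_apply, prism_join, map_sub, boundary_join,
      map_join, ih, boundary_map]
    abel

theorem map_prism (f g : E → E') (φ : E' → E'') {k : ℕ} (z : TupleChain E k) :
    map φ (k + 1) (prism f g k z) = prism (φ ∘ f) (φ ∘ g) k z := by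
  induction k with
  | zero => simp [prism]
  | succ k ih =>
    refine LinearMap.congr_fun (f := map φ (k + 2) ∘ₗ prism f g (k + 1))
      (g := prism (φ ∘ f) (φ ∘ g) (k + 1)) (hom_ext_join fun a v => ?_) z
    simp only [LinearMap.comp_apply, prism_join, map_sub, map_join, ih, map_map]
    rfl

theorem prism_map (f g : E' → E'') (φ : E → E') {k : ℕ} (z : TupleChain E k) :
    prism f g k (map φ k z) = prism (f ∘ φ) (g ∘ φ) k z := by
  induction k with
  | zero => simp [prism]
  | succ k ih =>
    refine LinearMap.congr_fun (f := prism f g (k + 1) ∘ₗ map φ (k + 1))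
      (g := prism (f ∘ φ) (g ∘ φ) (k + 1)) (hom_ext_join fun a v => ?_) z
    simp only [LinearMap.comp_apply, prism_join, map_join, ih, map_map]
    rfl

/-! ### Supports -/

/-- The chains all of whose tuples satisfy `Q`. -/
abbrev supported {k : ℕ} (Q : (Fin k → E) → Prop) : Submodule ℂ (TupleChain E k) :=
  Finsupp.supported ℂ ℂ {v | Q v}

theorem of_mem {k : ℕ} {Q : (Fin k → E) → Prop} {v : Fin k → E} (h : Q v) : of v ∈ supported Q :=
  Finsupp.single_mem_supported ℂ 1 h

theorem supported_mono {k : ℕ} {Q R : (Fin k → E) → Prop} (h : ∀ v, Q v → R v) :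
    supported Q ≤ supported R :=
  Finsupp.supported_mono h

/-- A linear map that sends every tuple with the property `Q` into a submodule sends every chain
of such tuples there. -/
theorem map_mem_of_supported {k : ℕ} {Q : (Fin k → E) → Prop} {M : Type*} [AddCommGroup M]
    [Module ℂ M] (f : TupleChain E k →ₗ[ℂ] M) (N : Submodule ℂ M)
    (h : ∀ v, Q v → f (of v) ∈ N) {z : TupleChain E k} (hz : z ∈ supported Q) : f z ∈ N := by
  rw [supported, Finsupp.supported_eq_span_single] at hz
  suffices Submodule.span ℂ ((fun v => of v) '' {v | Q v}) ≤ N.comap f from this hz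
  rw [Submodule.span_le]
  rintro _ ⟨v, hv, rfl⟩
  exact h v hv

theorem join_mem {k : ℕ} {Q : (Fin k → E) → Prop} {R : (Fin (k + 1) → E) → Prop} (a : E)
    (h : ∀ v, Q v → R (cons a v)) {z : TupleChain E k} (hz : z ∈ supported Q) :
    join a k z ∈ supported R :=
  map_mem_of_supported _ _ (fun v hv => by rw [join_of]; exact of_mem (h v hv)) hz

theorem map_mem {k : ℕ} {Q : (Fin k → E) → Prop} {R : (Fin k → E') → Prop} (φ : E → E')
    (h : ∀ v, Q v → R (φ ∘ v)) {z : TupleChain E k} (hz : z ∈ supported Q) :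
    map φ k z ∈ supported R :=
  map_mem_of_supported _ _ (fun v hv => by rw [map_of]; exact of_mem (h v hv)) hz

theorem boundary_mem {k : ℕ} {Q : (Fin (k + 1) → E) → Prop} {R : (Fin k → E) → Prop}
    (h : ∀ v, Q v → ∀ i : Fin (k + 1), R (v ∘ i.succAbove)) {z : TupleChain E (k + 1)}
    (hz : z ∈ supported Q) : boundary k z ∈ supported R :=
  map_mem_of_supported _ _ (fun v hv => by
    rw [boundary_of]
    exact Submodule.sum_mem _ fun i _ => Submodule.smul_mem _ _ (of_mem (h v hv i))) hz

/-- Controls the size of a prism: it is fine if `f` and `g` together move fine tuples only a little.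
-/
theorem prism_of_mem (f g : E → E') {k : ℕ} (v : Fin k → E) :
    prism f g k (of v) ∈
      supported fun u => ∀ i, ∃ j, u i = f (v j) ∨ u i = g (v j) := by
  induction k with
  | zero => simp [prism]
  | succ k ih =>
    have hv : of v = join (v 0) k (of (Fin.tail v)) := by
      rw [join_of, cons, Fin.cons_self_tail]
    rw [hv, prism_join, map_of]
    refine Submodule.sub_mem _ ?_ ?_
    · rw [join_of, join_of]
      refine of_mem fun i => ?_
      refine Fin.cases ⟨0, Or.inl rfl⟩ (fun i => ?_) i
      refine Fin.cases ⟨0, Or.inr rfl⟩ (fun i => ⟨i.succ, Or.inr rfl⟩) i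
    · refine join_mem _ (fun u hu i => ?_) (ih (Fin.tail v))
      refine Fin.cases ⟨0, Or.inl rfl⟩ (fun i => ?_) i
      obtain ⟨j, hj⟩ := hu i
      exact ⟨j.succ, hj⟩

end TupleChain

/-! ### Fine tuples in a convex set -/

section Convex

variable {E : Type} [NormedAddCommGroup E] [NormedSpace ℝ E] {S : Set E}

/-- The contraction of a convex set towards the point `p` at time `t`. -/
def Convex.contract (hS : Convex ℝ S) (p : S) (t : unitInterval) (x : S) : S :=
  ⟨(1 - (t : ℝ)) • (x : E) + (t : ℝ) • (p : E),
    hS x.2 p.2 (sub_nonneg.2 t.2.2) t.2.1 (by ring)⟩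

theorem Convex.contract_zero (hS : Convex ℝ S) (p : S) : hS.contract p 0 = id := by
  funext x
  simp [Convex.contract]

theorem Convex.contract_one (hS : Convex ℝ S) (p x : S) : hS.contract p 1 x = p := by
  simp [Convex.contract]

theorem Convex.contract_mem (hS : Convex ℝ S) {C : Set E} (hC : Convex ℝ C) {p x : S}
    (hp : (p : E) ∈ C) (hx : (x : E) ∈ C) (t : unitInterval) : (hS.contract p t x : E) ∈ C :=
  hC hx hp (sub_nonneg.2 t.2.2) t.2.1 (by ring)

theorem Convex.dist_contract_le (hS : Convex ℝ S) (p x y : S) (s t : unitInterval) :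
    dist (hS.contract p s x) (hS.contract p t y) ≤
      dist x y + |(t : ℝ) - s| * dist y p := by
  have h : (hS.contract p s x : E) - hS.contract p t y =
      (1 - (s : ℝ)) • ((x : E) - y) + ((t : ℝ) - s) • ((y : E) - p) := by
    simp only [Convex.contract]
    module
  rw [Subtype.dist_eq, Subtype.dist_eq, Subtype.dist_eq, dist_eq_norm, dist_eq_norm, dist_eq_norm,
    h]
  refine (norm_add_le _ _).trans ?_
  rw [norm_smul, norm_smul, Real.norm_eq_abs, Real.norm_eq_abs]
  gcongr
  refine mul_le_of_le_one_left (norm_nonneg _) ?_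
  rw [abs_of_nonneg (sub_nonneg.2 s.2.2)]
  linarith [s.2.1]

namespace TupleChain

/-- Any two entries of the tuple have distance less than `δ`. -/
def Fine (δ : ℝ) {k : ℕ} (v : Fin k → S) : Prop := ∀ i j, dist (v i) (v j) < δ

/-- All entries of the tuple lie in `C`. -/
def EntriesIn (C : Set E) {k : ℕ} (v : Fin k → S) : Prop := ∀ i, (v i : E) ∈ C

/-- The convex hull of the entries of a tuple. -/
def hull {k : ℕ} (v : Fin k → S) : Set E := convexHull ℝ (Set.range fun i => (v i : E))

theorem hull_subset {k : ℕ} {v : Fin k → S} {C : Set E} (hC : Convex ℝ C)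
    (h : EntriesIn C v) : hull v ⊆ C :=
  convexHull_min (Set.range_subset_iff.2 h) hC

theorem entriesIn_hull {k : ℕ} (v : Fin k → S) : EntriesIn (hull v) v := fun i =>
  subset_convexHull ℝ _ ⟨i, rfl⟩

theorem _root_.Finset.exists_lt_forall_le (F : Finset ℝ) {δ : ℝ} (h : ∀ x ∈ F, x < δ) :
    ∃ η < δ, ∀ x ∈ F, x ≤ η := by
  rcases F.eq_empty_or_nonempty with rfl | hF
  · exact ⟨δ - 1, by linarith, by simp⟩
  · exact ⟨F.max' hF, h _ (F.max'_mem hF), fun x hx => F.le_max' x hx⟩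

/-- A cycle of fine tuples in a convex set bounds a chain of fine tuples. -/
theorem exists_fine_boundary_eq (hS : Convex ℝ S) {C : Set E} (hC : Convex ℝ C) {p : S}
    (hp : (p : E) ∈ C) {δ : ℝ} (hδ : 0 < δ) {k : ℕ} {z : TupleChain S (k + 1)}
    (hz : z ∈ supported (Fine δ)) (hzC : z ∈ supported (EntriesIn C))
    (hb : boundary k z = 0) :
    ∃ u : TupleChain S (k + 2), u ∈ supported (Fine δ) ∧ u ∈ supported (EntriesIn C) ∧
      boundary (k + 1) u = z := by
  classical
  -- Only finitely many tuples occur, so a gap between their diameters and `δ` remains for the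
  -- motion below.
  obtain ⟨η, hη, hzη⟩ : ∃ η < δ, ∀ v ∈ z.support, ∀ i j, dist (v i) (v j) ≤ η := by
    obtain ⟨η, hη, h⟩ := Finset.exists_lt_forall_le
      ((z.support ×ˢ (Finset.univ : Finset (Fin (k + 1) × Fin (k + 1)))).image
        fun q => dist (q.1 q.2.1) (q.1 q.2.2)) (δ := δ) (by
        intro x hx
        obtain ⟨q, hq, rfl⟩ := Finset.mem_image.1 hx
        exact hz (Finset.mem_product.1 hq).1 _ _)
    exact ⟨η, hη, fun v hv i j => h _ (Finset.mem_image.2 ⟨(v, i, j), by simpa using hv, rfl⟩)⟩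
  obtain ⟨R, hR⟩ : ∃ R, ∀ v ∈ z.support, ∀ i, dist (v i) p ≤ R := by
    obtain ⟨R, h⟩ := Finset.exists_le
      ((z.support ×ˢ (Finset.univ : Finset (Fin (k + 1)))).image fun q => dist (q.1 q.2) p)
    exact ⟨R, fun v hv i => h _ (Finset.mem_image.2 ⟨(v, i), by simpa using hv, rfl⟩)⟩
  -- The contraction is cut into `N` time steps; in each one a point at distance at most `R` from
  -- `p` moves by at most `R / N`, less than the gap `δ - η`.
  obtain ⟨N, hN⟩ := exists_nat_gt (max 0 (R / (δ - η)))
  have hN0 : (0 : ℝ) < N := (le_max_left _ _).trans_lt hN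
  have hRN : η + 1 / N * R < δ := by
    have h1 : R / (δ - η) < N := (le_max_right _ _).trans_lt hN
    rw [div_lt_iff₀ (by linarith)] at h1
    have : 1 / N * R < δ - η := by
      rw [one_div, inv_mul_lt_iff₀ hN0]
      linarith
    linarith
  let τ : ℕ → unitInterval := fun j => Set.projIcc 0 1 zero_le_one ((j : ℝ) / N)
  have hτ : ∀ j, |(τ (j + 1) : ℝ) - τ j| ≤ 1 / N := fun j => by
    refine (Set.abs_projIcc_sub_projIcc zero_le_one).trans_eq ?_
    push_cast
    rw [← sub_div, add_sub_cancel_left, abs_of_pos (by positivity)]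
  have hzQ : z ∈ supported fun v => (∀ i j, dist (v i) (v j) ≤ η) ∧ (∀ i, dist (v i) p ≤ R) ∧
      EntriesIn C v := fun v hv => ⟨hzη v hv, hR v hv, hzC hv⟩
  -- The prisms between consecutive times are fine; their sum joins `z` to its contraction at time
  -- τ_j.
  have step : ∀ j : ℕ, ∃ u : TupleChain S (k + 2), u ∈ supported (Fine δ) ∧
      u ∈ supported (EntriesIn C) ∧
      boundary (k + 1) u = map (hS.contract p (τ j)) (k + 1) z - z := by
    intro j
    induction j with
    | zero =>
      refine ⟨0, Submodule.zero_mem _, Submodule.zero_mem _, ?_⟩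
      have : τ 0 = 0 := by simp [τ]
      rw [this, hS.contract_zero, map_id, map_zero, sub_self]
    | succ j ih =>
      obtain ⟨u, hu, huC, hub⟩ := ih
      refine ⟨u + prism (hS.contract p (τ j)) (hS.contract p (τ (j + 1))) (k + 1) z,
        Submodule.add_mem _ hu ?_, Submodule.add_mem _ huC ?_, ?_⟩
      · refine map_mem_of_supported _ _ (fun v hv => ?_) hzQ
        refine supported_mono (fun w hw => ?_) (prism_of_mem _ _ v)
        intro a b
        have key : ∀ s t : unitInterval, |(t : ℝ) - s| ≤ 1 / N → ∀ x y,
            dist (hS.contract p s (v x)) (hS.contract p t (v y)) < δ := by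
          intro s t hst x y
          refine (hS.dist_contract_le _ _ _ _ _).trans_lt (lt_of_le_of_lt ?_ hRN)
          exact add_le_add (hv.1 x y) (mul_le_mul hst (hv.2.1 y) dist_nonneg (by positivity))
        have h1 := hτ j
        have h2 : |(τ j : ℝ) - τ (j + 1)| ≤ 1 / N := by rw [abs_sub_comm]; exact hτ j
        obtain ⟨x, hx⟩ := hw a
        obtain ⟨y, hy⟩ := hw b
        rcases hx with hx | hx <;> rcases hy with hy | hy <;> rw [hx, hy] <;> apply key <;>
          first | assumption | simp
      · refine map_mem_of_supported _ _ (fun v hv => ?_) hzQ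
        refine supported_mono (fun w hw a => ?_) (prism_of_mem _ _ v)
        obtain ⟨x, hx⟩ := hw a
        rcases hx with hx | hx <;> rw [hx] <;> exact hS.contract_mem hC hp (hv.2.2 x) _
      · rw [map_add, hub, boundary_prism, hb, map_zero]
        abel
  obtain ⟨u, hu, huC, hub⟩ := step N
  have hτN : τ N = 1 := by
    simp only [τ, div_self hN0.ne']
    exact Set.projIcc_right ..
  rw [hτN] at hub
  -- At time 1 all tuples are constant at `p`. The cone from `p` over them is again constant, hence
  -- fine, and bounds the contracted cycle.
  have hmap : ∀ Q : (Fin (k + 2) → S) → Prop, Q (fun _ => p) →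
      join p (k + 1) (map (hS.contract p 1) (k + 1) z) ∈ supported Q := by
    intro Q hQ
    refine join_mem p (Q := fun v => v = fun _ => p) (fun v hv => ?_)
      (map_mem _ (fun v _ => ?_) hz)
    · convert hQ using 1
      funext i
      refine Fin.cases ?_ (fun j => ?_) i <;> simp [hv]
    · funext i
      exact hS.contract_one p (v i)
  refine ⟨join p (k + 1) (map (hS.contract p 1) (k + 1) z) - u,
    Submodule.sub_mem _ (hmap _ fun i j => by simpa using hδ) hu,
    Submodule.sub_mem _ (hmap _ fun i => hp) huC, ?_⟩
  rw [map_sub, boundary_join, boundary_map, hb, hub, map_zero, map_zero]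
  abel

/-- A linear operator on chains that sends every tuple to a chain in its convex hull. -/
def IsCarried {k l : ℕ} (D : TupleChain S k →ₗ[ℂ] TupleChain S l) : Prop :=
  ∀ v, D (of v) ∈ supported (EntriesIn (hull v))

theorem IsCarried.mem {k l : ℕ} {D : TupleChain S k →ₗ[ℂ] TupleChain S l} (hD : IsCarried D)
    {C : Set E} (hC : Convex ℝ C) {z : TupleChain S k} (hz : z ∈ supported (EntriesIn C)) :
    D z ∈ supported (EntriesIn C) :=
  map_mem_of_supported _ _
    (fun v hv => supported_mono (fun _ hu i => hull_subset hC hv (hu i)) (hD v)) hz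

/-- There is a natural way to make all chains fine. -/
theorem exists_subdivision (hS : Convex ℝ S) {δ : ℝ} (hδ : 0 < δ) (k : ℕ) :
    ∃ (D₀ : TupleChain S k →ₗ[ℂ] TupleChain S (k + 1))
      (D₁ : TupleChain S (k + 1) →ₗ[ℂ] TupleChain S (k + 2)), IsCarried D₀ ∧ IsCarried D₁ ∧
      ∀ z, z - boundary (k + 1) (D₁ z) - D₀ (boundary k z) ∈ supported (Fine δ) := by
  induction k with
  | zero =>
    -- A tuple with one entry has diameter zero, so nothing has to be subdivided.
    refine ⟨0, 0, fun v => Submodule.zero_mem _, fun v => Submodule.zero_mem _, fun z => ?_⟩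
    simp only [LinearMap.zero_apply, map_zero, sub_zero]
    intro v _ i j
    rw [show i = j from Fin.ext (by omega), dist_self]
    exact hδ
  | succ k ih =>
    obtain ⟨D₀, D₁, -, hD₁, hD⟩ := ih
    have key : ∀ v : Fin (k + 2) → S, ∃ y : TupleChain S (k + 3),
        y ∈ supported (EntriesIn (hull v)) ∧
        of v - boundary (k + 2) y - D₁ (boundary (k + 1) (of v)) ∈ supported (Fine δ) := by
      intro v
      have hC : Convex ℝ (hull v) := convex_convexHull ℝ _
      -- By induction ∂w is fine, and it is a cycle, so it bounds a fine `u`. Then `w - u` is a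
      -- cycle in the convex hull and bounds the cone from `v 0`; what is left of `v` is exactly
      -- `u`.
      set w := of v - D₁ (boundary (k + 1) (of v)) with hw
      have hwC : w ∈ supported (EntriesIn (hull v)) :=
        Submodule.sub_mem _ (of_mem (entriesIn_hull v))
          (hD₁.mem hC (boundary_mem (fun u hu i j => hu _) (of_mem (entriesIn_hull v))))
      have hbw : boundary (k + 1) w ∈ supported (Fine δ) := by
        have := hD (boundary (k + 1) (of v))
        rwa [boundary_boundary, map_zero, sub_zero, ← map_sub] at this
      obtain ⟨u, hu, huC, hub⟩ := exists_fine_boundary_eq hS hC (entriesIn_hull v 0) hδ hbw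
        (boundary_mem (fun u hu i j => hu _) hwC) (boundary_boundary w)
      refine ⟨join (v 0) (k + 2) (w - u), join_mem _ (fun x hx i => ?_)
        (Submodule.sub_mem _ hwC huC), ?_⟩
      · refine Fin.cases (entriesIn_hull v 0) (fun j => hx j) i
      · rw [boundary_join, map_sub, hub, sub_self, map_zero, sub_zero]
        have : of v - (w - u) - D₁ (boundary (k + 1) (of v)) = u := by
          rw [hw]
          abel
        rwa [this]
    choose y hy hy' using key
    refine ⟨D₁, Finsupp.linearCombination ℂ y, hD₁, fun v => ?_, fun z => ?_⟩
    · simpa using hy v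
    · refine map_mem_of_supported (Q := fun _ => True)
        (LinearMap.id - boundary (k + 2) ∘ₗ Finsupp.linearCombination ℂ y -
          D₁ ∘ₗ boundary (k + 1)) _ (fun v _ => ?_) fun _ _ => trivial
      simpa using hy' v

/-- Let `Q` be a property of tuples which holds for fine tuples, and which passes to tuples in the
convex hull.  A chain whose boundary has the property `Q` is, up to a boundary, a chain with the
property `Q`. -/
theorem exists_sub_boundary_mem (hS : Convex ℝ S) (Q : ∀ {k : ℕ}, (Fin k → S) → Prop)
    {δ : ℝ} (hδ : 0 < δ) (hfine : ∀ {k : ℕ} (v : Fin (k + 1) → S), Fine δ v → Q v)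
    (hhull : ∀ {k l : ℕ} (v : Fin k → S) (u : Fin l → S), Q v → EntriesIn (hull v) u → Q u)
    {k : ℕ} {w : TupleChain S (k + 1)} (hw : boundary k w ∈ supported Q) :
    ∃ y, w - boundary (k + 1) y ∈ supported Q := by
  obtain ⟨D₀, D₁, hD₀, -, hD⟩ := exists_subdivision hS hδ k
  refine ⟨D₁ w, ?_⟩
  -- `D₀` stays inside convex hulls, so it preserves the property that the boundary already has.
  have h1 : D₀ (boundary k w) ∈ supported Q :=
    map_mem_of_supported _ _ (fun v hv => supported_mono (fun u hu => hhull v u hv hu) (hD₀ v)) hw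
  have h2 := Submodule.add_mem _ (supported_mono hfine (hD w)) h1
  rwa [sub_add_cancel] at h2

end TupleChain

end Convex

/-! ### Affine simplices in a convex set -/

section Affine

variable {E E' : Type} [NormedAddCommGroup E] [NormedSpace ℝ E] [NormedAddCommGroup E']
  [NormedSpace ℝ E'] {S : Set E} {S' : Set E'}

/-- The affine simplex with given vertices in a convex set. -/
def Convex.simplex (hS : Convex ℝ S) {m : ℕ} (v : Fin (m + 1) → S) :
    C(TopSimplex (SimplexCategory.mk m), S) where
  toFun t := ⟨∑ i : Fin (m + 1), t i • (v i : E),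
    hS.sum_mem (fun i _ => t.2.1 i) t.2.2 fun i _ => (v i).2⟩
  continuous_toFun := by
    refine Continuous.subtype_mk (continuous_finsetSum _ fun i _ => ?_) _
    exact ((continuous_apply i).comp continuous_subtype_val).smul continuous_const

theorem Convex.simplex_coe (hS : Convex ℝ S) {m : ℕ} (v : Fin (m + 1) → S)
    (t : TopSimplex (SimplexCategory.mk m)) :
    (hS.simplex v t : E) = ∑ i : Fin (m + 1), t i • (v i : E) := rfl

/-- The barycentric coordinates of the image point are sums over the fibres of `θ`. -/
theorem Convex.simplex_comp_map (hS : Convex ℝ S) {m n : ℕ} (v : Fin (n + 1) → S)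
    (θ : SimplexCategory.mk m ⟶ SimplexCategory.mk n) :
    (hS.simplex v).comp (TopSimplex.map θ) = hS.simplex fun i => v (θ i) := by
  ext t
  change ∑ j : Fin (n + 1), (stdSimplex.map θ t) j • (v j : E) =
    ∑ i : Fin (m + 1), t i • (v (θ i) : E)
  simp only [stdSimplex.map_coe, FunOnFinite.linearMap_apply_apply, Finset.sum_smul]
  have := Finset.sum_fiberwise (Finset.univ : Finset (Fin (m + 1))) (fun i => (θ i : Fin (n + 1)))
    fun i => t i • (v (θ i) : E)
  rw [← this]
  refine Finset.sum_congr rfl fun j _ => Finset.sum_congr rfl fun i hi => ?_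
  rw [(Finset.mem_filter.1 hi).2]

theorem Convex.simplex_mem_hull (hS : Convex ℝ S) {m : ℕ} (v : Fin (m + 1) → S)
    (t : TopSimplex (SimplexCategory.mk m)) : (hS.simplex v t : E) ∈ TupleChain.hull v :=
  (convex_convexHull ℝ _).sum_mem (fun i _ => t.2.1 i) t.2.2
    fun i _ => TupleChain.entriesIn_hull v i

/-- A map of convex sets that preserves convex combinations. -/
def Convex.IsAffine (hS : Convex ℝ S) (hS' : Convex ℝ S') (φ : C(S, S')) : Prop :=
  ∀ {m : ℕ} (v : Fin (m + 1) → S), φ.comp (hS.simplex v) = hS'.simplex (φ ∘ v)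

end Affine

/-! ### The standard simplex as an affine simplex -/

namespace TopSimplex

/-- The tuple of all vertices of the standard simplex. -/
def vertices (n : ℕ) : Fin (n + 1) → TopSimplex (SimplexCategory.mk n) := fun i =>
  stdSimplex.vertex (S := ℝ) i

theorem simplex_vertices (n : ℕ) :
    (convex_stdSimplex ℝ (Fin (n + 1))).simplex (vertices n) = ContinuousMap.id _ := by
  ext t j
  change (∑ i : Fin (n + 1), t i • (Pi.single i 1 : Fin (n + 1) → ℝ)) j = t j
  simp [Finset.sum_apply, Pi.single_apply]

theorem map_δ_comp_vertices (n : ℕ) (i : Fin (n + 2)) :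
    map (SimplexCategory.δ i) ∘ vertices n = vertices (n + 1) ∘ i.succAbove := by
  funext j
  exact stdSimplex.map_vertex _ _

theorem isAffine_map {m n : ℕ} (θ : SimplexCategory.mk m ⟶ SimplexCategory.mk n) :
    (convex_stdSimplex ℝ (Fin (m + 1))).IsAffine (convex_stdSimplex ℝ (Fin (n + 1)))
      (map θ) := by
  intro l v
  ext t j
  change (stdSimplex.map θ ((convex_stdSimplex ℝ (Fin (m + 1))).simplex v t)) j =
    (∑ i : Fin (l + 1), t i • (stdSimplex.map θ (v i) : Fin (n + 1) → ℝ)) j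
  simp only [stdSimplex.map_coe]
  have h : (((convex_stdSimplex ℝ (Fin (m + 1))).simplex v t : _) : Fin (m + 1) → ℝ) =
    ∑ i : Fin (l + 1), t i • (v i : Fin (m + 1) → ℝ) := rfl
  erw [h]
  rw [map_sum]
  simp only [LinearMap.map_smul]

end TopSimplex

namespace LocalSystem

variable {Y : Type} [TopologicalSpace Y] (L : LocalSystem Y)

/-! ### The differential -/

/-- The differential of singular cochains. -/
def d (n : ℕ) : Cochain L (SimplexCategory.mk n) →ₗ[ℂ] Cochain L (SimplexCategory.mk (n + 1)) :=
  ∑ i : Fin (n + 2), ((-1 : ℂ) ^ (i : ℕ)) • cochainMap L (SimplexCategory.δ i)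

theorem d_apply {n : ℕ} (c : Cochain L (SimplexCategory.mk n))
    (σ : C(TopSimplex (SimplexCategory.mk (n + 1)), Y)) :
    L.d n c σ = ∑ i : Fin (n + 2), ((-1 : ℂ) ^ (i : ℕ)) •
      cochainMap L (SimplexCategory.δ i) c σ := by
  simp [d, LinearMap.sum_apply, Finset.sum_apply]

/-- The alternating coface complex carries integer signs, whereas `d` carries complex ones. -/
theorem ofHom_d (n : ℕ) : ModuleCat.ofHom (L.d n) =
    ∑ i : Fin (n + 2), ((-1 : ℤ) ^ (i : ℕ)) •
      ModuleCat.ofHom (cochainMap L (SimplexCategory.δ i)) := by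
  apply ModuleCat.hom_ext
  simp only [d, ModuleCat.hom_sum, ModuleCat.hom_zsmul, ModuleCat.hom_ofHom]
  refine Finset.sum_congr rfl fun i _ => ?_
  rw [← Int.cast_smul_eq_zsmul ℂ]
  push_cast
  rfl

theorem cochainComplex_d (n : ℕ) : (cochainComplex L).d n (n + 1) = ModuleCat.ofHom (L.d n) :=
  (CochainComplex.of_d (fun n => (cosimplicialCochains L).obj (SimplexCategory.mk n))
    (AlgebraicTopology.AlternatingCofaceMapComplex.objD (cosimplicialCochains L)) n).trans
    (L.ofHom_d n).symm

theorem d_d {n : ℕ} (c : Cochain L (SimplexCategory.mk n)) : L.d (n + 1) (L.d n c) = 0 := by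
  have h := (cochainComplex L).d_comp_d n (n + 1) (n + 2)
  rw [cochainComplex_d, cochainComplex_d] at h
  exact LinearMap.congr_fun (congrArg ModuleCat.Hom.hom h) c

/-! ### Transport along maps of contractible spaces -/

section Transport

variable {K : Type} [TopologicalSpace K] [ContractibleSpace K]

/-- A path class between two points of a contractible space. -/
def contractibleHom (a b : K) : FundamentalGroupoid.mk a ⟶ FundamentalGroupoid.mk b :=
  FundamentalGroupoid.fromPath (Path.Homotopic.Quotient.mk (PathConnectedSpace.somePath a b))

theorem contractible_hom_eq {a b : FundamentalGroupoid K} (p q : a ⟶ b) : p = q :=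
  Subsingleton.elim (α := Path.Homotopic.Quotient a.as b.as) p q

/-- Parallel transport in `L` along the image of a path in a contractible space. -/
def trans (κ : C(K, Y)) (a b : K) : L.obj ⟨κ a⟩ →ₗ[ℂ] L.obj ⟨κ b⟩ :=
  (L.map ((FundamentalGroupoid.map κ).map (contractibleHom a b))).hom

theorem trans_eq (κ : C(K, Y)) {a b : K} (p : FundamentalGroupoid.mk a ⟶ FundamentalGroupoid.mk b) :
    L.trans κ a b = (L.map ((FundamentalGroupoid.map κ).map p)).hom := by
  rw [trans, contractible_hom_eq (contractibleHom a b) p]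

theorem trans_trans (κ : C(K, Y)) (a b e : K) (x : L.obj ⟨κ a⟩) :
    L.trans κ b e (L.trans κ a b x) = L.trans κ a e x := by
  rw [trans_eq L κ (contractibleHom a b ≫ contractibleHom b e), Functor.map_comp,
    Functor.map_comp]
  rfl

theorem trans_self (κ : C(K, Y)) (a : K) (x : L.obj ⟨κ a⟩) : L.trans κ a a x = x := by
  rw [trans_eq L κ (𝟙 _), CategoryTheory.Functor.map_id, CategoryTheory.Functor.map_id]
  rfl

theorem trans_comp {K' : Type} [TopologicalSpace K'] [ContractibleSpace K'] (κ : C(K', Y))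
    (φ : C(K, K')) (a b : K) : L.trans (κ.comp φ) a b = L.trans κ (φ a) (φ b) :=
  (L.trans_eq κ ((FundamentalGroupoid.map φ).map (contractibleHom a b))).symm

theorem transport_eq_trans {n : SimplexCategory} (σ : C(TopSimplex n, Y)) (a b : TopSimplex n) :
    (transport L σ a b).hom = L.trans σ a b :=
  (L.trans_eq σ _).symm

/-- The value of `c` on `κ ∘ φ`, transported to the fibre over `κ b`. -/
def evalAt (κ : C(K, Y)) (b : K) {n : SimplexCategory} (φ : C(TopSimplex n, K)) :
    Cochain L n →ₗ[ℂ] L.obj ⟨κ b⟩ :=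
  L.trans κ (φ (TopSimplex.base n)) b ∘ₗ
    LinearMap.proj (R := ℂ) (φ := fun τ : C(TopSimplex n, Y) =>
        (L.obj ⟨τ (TopSimplex.base n)⟩ : Type)) (κ.comp φ)

theorem evalAt_apply (κ : C(K, Y)) (b : K) {n : SimplexCategory} (φ : C(TopSimplex n, K))
    (c : Cochain L n) :
    L.evalAt κ b φ c = L.trans κ (φ (TopSimplex.base n)) b (c (κ.comp φ)) := rfl

/-- The transport built into each face operator and the transport to `κ b` compose to one transport,
because path classes in `K` are unique. -/
theorem evalAt_d (κ : C(K, Y)) (b : K) {n : ℕ}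
    (φ : C(TopSimplex (SimplexCategory.mk (n + 1)), K)) (c : Cochain L (SimplexCategory.mk n)) :
    L.evalAt κ b φ (L.d n c) = ∑ i : Fin (n + 2), ((-1 : ℂ) ^ (i : ℕ)) •
      L.evalAt κ b (φ.comp (TopSimplex.map (SimplexCategory.δ i))) c := by
  rw [evalAt_apply, d_apply, map_sum]
  refine Finset.sum_congr rfl fun i _ => ?_
  rw [LinearMap.map_smul, cochainMap_apply, evalAt_apply, transport_eq_trans]
  have h := L.trans_comp κ φ (TopSimplex.map (SimplexCategory.δ i)
    (TopSimplex.base (SimplexCategory.mk n))) (TopSimplex.base _)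
  refine congrArg _ ?_
  exact (congrArg _ (LinearMap.congr_fun h _)).trans (L.trans_trans κ _ _ _ _)

end Transport

/-! ### The pairing of chains in a convex set with cochains -/

section Pairing

variable {E E' : Type} [NormedAddCommGroup E] [NormedSpace ℝ E] [NormedAddCommGroup E']
  [NormedSpace ℝ E'] {S : Set E} {S' : Set E'} [ContractibleSpace S] [ContractibleSpace S']

/-- The pairing of affine chains in `S` with cochains on `Y`, where `S` is a convex set with a map
`κ` to `Y`; the values are transported to the fibre over `κ b`. -/
def pair (hS : Convex ℝ S) (κ : C(S, Y)) (b : S) (m : ℕ) :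
    TupleChain S (m + 1) →ₗ[ℂ] Cochain L (SimplexCategory.mk m) →ₗ[ℂ] L.obj ⟨κ b⟩ :=
  Finsupp.linearCombination ℂ fun v => L.evalAt κ b (hS.simplex v)

theorem pair_of (hS : Convex ℝ S) (κ : C(S, Y)) (b : S) {m : ℕ} (v : Fin (m + 1) → S) :
    L.pair hS κ b m (TupleChain.of v) = L.evalAt κ b (hS.simplex v) := by
  simp [pair]

/-- Stokes' formula. It makes sense with twisted coefficients because all values are moved to the
single fibre over `κ b`. -/
theorem pair_d (hS : Convex ℝ S) (κ : C(S, Y)) (b : S) {m : ℕ} (z : TupleChain S (m + 2))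
    (c : Cochain L (SimplexCategory.mk m)) :
    L.pair hS κ b (m + 1) z (L.d m c) = L.pair hS κ b m (TupleChain.boundary (m + 1) z) c := by
  suffices h : (L.d m).lcomp ℂ _ ∘ₗ L.pair hS κ b (m + 1) =
      L.pair hS κ b m ∘ₗ TupleChain.boundary (m + 1) from
    LinearMap.congr_fun (LinearMap.congr_fun h z) c
  refine TupleChain.hom_ext fun v => LinearMap.ext fun c => ?_
  change L.pair hS κ b (m + 1) (TupleChain.of v) (L.d m c) = _
  rw [pair_of, evalAt_d, LinearMap.comp_apply, TupleChain.boundary_of, map_sum,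
    LinearMap.sum_apply]
  refine Finset.sum_congr rfl fun i _ => ?_
  rw [LinearMap.map_smul, LinearMap.smul_apply, pair_of, hS.simplex_comp_map]
  rfl

theorem pair_map (hS : Convex ℝ S) (hS' : Convex ℝ S') (κ : C(S', Y)) {φ : C(S, S')}
    (hφ : hS.IsAffine hS' φ) (b : S) {m : ℕ} (z : TupleChain S (m + 1)) :
    L.pair hS' κ (φ b) m (TupleChain.map φ (m + 1) z) = L.pair hS (κ.comp φ) b m z := by
  suffices h : L.pair hS' κ (φ b) m ∘ₗ TupleChain.map φ (m + 1) = L.pair hS (κ.comp φ) b m from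
    LinearMap.congr_fun h z
  refine TupleChain.hom_ext fun v => LinearMap.ext fun c => ?_
  rw [LinearMap.comp_apply, TupleChain.map_of, pair_of, pair_of, ← hφ, evalAt_apply, evalAt_apply,
    trans_comp]
  rfl

theorem trans_pair (hS : Convex ℝ S) (κ : C(S, Y)) (a b : S) {m : ℕ} (z : TupleChain S (m + 1))
    (c : Cochain L (SimplexCategory.mk m)) :
    L.trans κ a b (L.pair hS κ a m z c) = L.pair hS κ b m z c := by
  suffices h : LinearMap.compRight ℂ (L.trans κ a b) ∘ₗ L.pair hS κ a m = L.pair hS κ b m from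
    LinearMap.congr_fun (LinearMap.congr_fun h z) c
  refine TupleChain.hom_ext fun v => LinearMap.ext fun c => ?_
  change L.trans κ a b (L.pair hS κ a m (TupleChain.of v) c) = _
  rw [pair_of, pair_of, evalAt_apply, evalAt_apply, trans_trans]

theorem pair_eq_zero (hS : Convex ℝ S) (κ : C(S, Y)) (b : S) {m : ℕ} {z : TupleChain S (m + 1)}
    {c : Cochain L (SimplexCategory.mk m)}
    (h : z ∈ TupleChain.supported fun v => c (κ.comp (hS.simplex v)) = 0) :
    L.pair hS κ b m z c = 0 := by
  refine TupleChain.map_mem_of_supported ((L.pair hS κ b m).flip c) ⊥ (fun v hv => ?_) h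
  change L.pair hS κ b m (TupleChain.of v) c = 0
  rw [pair_of, evalAt_apply, hv, map_zero]

theorem pair_vertices {n : ℕ} (σ : C(TopSimplex (SimplexCategory.mk n), Y))
    (c : Cochain L (SimplexCategory.mk n)) :
    L.pair (convex_stdSimplex ℝ (Fin (n + 1))) σ (TopSimplex.base (SimplexCategory.mk n)) n
      (TupleChain.of (TopSimplex.vertices n)) c = c σ := by
  rw [pair_of, TopSimplex.simplex_vertices, evalAt_apply]
  exact L.trans_self σ _ _

end Pairing

end LocalSystem

/-! ### Small simplices -/

namespace TopSimplex

/-- The affine map of standard simplices induced by an arbitrary map of vertices. -/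
def vmap {m n : ℕ} (θ : Fin (m + 1) → Fin (n + 1)) :
    C(TopSimplex (SimplexCategory.mk m), TopSimplex (SimplexCategory.mk n)) :=
  ⟨stdSimplex.map θ, stdSimplex.continuous_map θ⟩

theorem vmap_vmap {l m n : ℕ} (θ : Fin (l + 1) → Fin (m + 1)) (η : Fin (m + 1) → Fin (n + 1)) :
    (vmap η).comp (vmap θ) = vmap (η ∘ θ) := by
  ext1 x
  exact stdSimplex.map_comp_apply (S := ℝ) θ η x

theorem vmap_comp_vertices {m n : ℕ} (θ : Fin (m + 1) → Fin (n + 1)) :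
    vmap θ ∘ vertices m = vertices n ∘ θ := by
  funext j
  exact stdSimplex.map_vertex _ _

theorem isLinearMap_vmap {m n : ℕ} (θ : Fin (m + 1) → Fin (n + 1)) :
    ∃ f : (Fin (m + 1) → ℝ) →ₗ[ℝ] (Fin (n + 1) → ℝ), ∀ x : TopSimplex (SimplexCategory.mk m),
      (vmap θ x : Fin (n + 1) → ℝ) = f x :=
  ⟨FunOnFinite.linearMap ℝ ℝ θ, fun _ => rfl⟩

/-- A linear map carries the convex hull of a set onto the convex hull of its image. -/
theorem vmap_mem_hull {m n k : ℕ} (θ : Fin (m + 1) → Fin (n + 1))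
    (v : Fin k → TopSimplex (SimplexCategory.mk m)) {y : TopSimplex (SimplexCategory.mk n)}
    (hy : (y : Fin (n + 1) → ℝ) ∈ TupleChain.hull (vmap θ ∘ v)) :
    ∃ x : TopSimplex (SimplexCategory.mk m),
      (x : Fin (m + 1) → ℝ) ∈ TupleChain.hull v ∧ vmap θ x = y := by
  obtain ⟨f, hf⟩ := isLinearMap_vmap θ
  have h : TupleChain.hull (vmap θ ∘ v) = f '' TupleChain.hull v := by
    rw [TupleChain.hull, TupleChain.hull, f.image_convexHull, ← Set.range_comp]
    congr 2
    funext i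
    exact hf _
  rw [h] at hy
  obtain ⟨x, hx, hxy⟩ := hy
  have hxS : x ∈ stdSimplex ℝ (Fin (m + 1)) :=
    TupleChain.hull_subset (convex_stdSimplex ℝ _) (fun i => (v i).2) hx
  exact ⟨⟨x, hxS⟩, hx, Subtype.ext ((hf _).trans hxy)⟩

end TopSimplex

namespace SmallSimplices

variable {Y : Type} [TopologicalSpace Y] (U V : Set Y)

/-- The simplex lies in `U` or in `V`. -/
def IsSmall {n : ℕ} (σ : C(TopSimplex (SimplexCategory.mk n), Y)) : Prop :=
  (∀ p, σ p ∈ U) ∨ ∀ p, σ p ∈ V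

/-- The simplex `σ` maps the convex hull of the tuple into `U` or into `V`. -/
def SmallTuple {n : ℕ} (σ : C(TopSimplex (SimplexCategory.mk n), Y)) {k : ℕ}
    (v : Fin k → TopSimplex (SimplexCategory.mk n)) : Prop :=
  (∀ x : TopSimplex (SimplexCategory.mk n), (x : Fin (n + 1) → ℝ) ∈ TupleChain.hull v → σ x ∈ U) ∨
    ∀ x : TopSimplex (SimplexCategory.mk n), (x : Fin (n + 1) → ℝ) ∈ TupleChain.hull v → σ x ∈ V

variable {U V}

theorem SmallTuple.isSmall {n : ℕ} {σ : C(TopSimplex (SimplexCategory.mk n), Y)} {k : ℕ}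
    {v : Fin (k + 1) → TopSimplex (SimplexCategory.mk n)} (h : SmallTuple U V σ v) :
    IsSmall U V (σ.comp ((convex_stdSimplex ℝ (Fin (n + 1))).simplex v)) :=
  h.imp (fun h p => h _ (Convex.simplex_mem_hull _ v p))
    fun h p => h _ (Convex.simplex_mem_hull _ v p)

theorem IsSmall.smallTuple {n : ℕ} {σ : C(TopSimplex (SimplexCategory.mk n), Y)}
    (h : IsSmall U V σ) {k : ℕ} (v : Fin k → TopSimplex (SimplexCategory.mk n)) :
    SmallTuple U V σ v :=
  h.imp (fun h x _ => h x) fun h x _ => h x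

theorem SmallTuple.of_hull {n : ℕ} {σ : C(TopSimplex (SimplexCategory.mk n), Y)} {k l : ℕ}
    {v : Fin k → TopSimplex (SimplexCategory.mk n)}
    {u : Fin l → TopSimplex (SimplexCategory.mk n)} (h : SmallTuple U V σ v)
    (hu : TupleChain.EntriesIn (TupleChain.hull v) u) : SmallTuple U V σ u := by
  have := TupleChain.hull_subset (convex_convexHull ℝ _) hu
  exact h.imp (fun h x hx => h x (this hx)) fun h x hx => h x (this hx)

theorem SmallTuple.vmap {m n : ℕ} {σ : C(TopSimplex (SimplexCategory.mk n), Y)}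
    {θ : Fin (m + 1) → Fin (n + 1)} {k : ℕ} {v : Fin k → TopSimplex (SimplexCategory.mk m)}
    (h : SmallTuple U V (σ.comp (TopSimplex.vmap θ)) v) :
    SmallTuple U V σ (TopSimplex.vmap θ ∘ v) := by
  refine h.imp (fun h y hy => ?_) fun h y hy => ?_ <;>
  · obtain ⟨x, hx, rfl⟩ := TopSimplex.vmap_mem_hull θ v hy
    exact h x hx

/-- Fine tuples are small. -/
theorem exists_fine_smallTuple (hU : IsOpen U) (hV : IsOpen V) {n : ℕ}
    (σ : C(TopSimplex (SimplexCategory.mk n), Y)) (hσ : ∀ p, σ p ∈ U ∪ V) :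
    ∃ δ > 0, ∀ {k : ℕ} (v : Fin (k + 1) → TopSimplex (SimplexCategory.mk n)),
      TupleChain.Fine δ v → SmallTuple U V σ v := by
  have : CompactSpace (TopSimplex (SimplexCategory.mk n)) :=
    isCompact_iff_compactSpace.1 (isCompact_stdSimplex ℝ _)
  obtain ⟨δ, hδ, h⟩ := lebesgue_number_lemma_of_metric (s := Set.univ)
    (c := fun b : Bool => σ ⁻¹' (if b then U else V)) isCompact_univ
    (fun b => IsOpen.preimage σ.continuous (by cases b <;> assumption)) (fun p _ => by
      rcases hσ p with h | h
      · exact Set.mem_iUnion.2 ⟨true, h⟩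
      · exact Set.mem_iUnion.2 ⟨false, h⟩)
  refine ⟨δ, hδ, fun {k} v hv => ?_⟩
  -- Balls are convex, so the Lebesgue number controls the whole hull of a fine tuple.
  have hull_ball : TupleChain.hull v ⊆ Metric.ball (v 0 : Fin (n + 1) → ℝ) δ :=
    TupleChain.hull_subset (convex_ball _ _) fun i => hv i 0
  obtain ⟨b, hb⟩ := h (v 0) trivial
  cases b
  · exact Or.inr fun x hx => hb (hull_ball hx)
  · exact Or.inl fun x hx => hb (hull_ball hx)

/-- The operator on chains of vertices induced by a choice of a chain for every simplex. -/
def extend {k : ℕ} (D : C(TopSimplex (SimplexCategory.mk k), Y) →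
      TupleChain (TopSimplex (SimplexCategory.mk k)) (k + 2)) {n : ℕ}
    (σ : C(TopSimplex (SimplexCategory.mk n), Y)) :
    TupleChain (Fin (n + 1)) (k + 1) →ₗ[ℂ]
      TupleChain (TopSimplex (SimplexCategory.mk n)) (k + 2) :=
  Finsupp.linearCombination ℂ fun θ =>
    TupleChain.map (TopSimplex.vmap θ) (k + 2) (D (σ.comp (TopSimplex.vmap θ)))

theorem extend_of {k : ℕ} (D : C(TopSimplex (SimplexCategory.mk k), Y) →
      TupleChain (TopSimplex (SimplexCategory.mk k)) (k + 2)) {n : ℕ}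
    (σ : C(TopSimplex (SimplexCategory.mk n), Y)) (θ : Fin (k + 1) → Fin (n + 1)) :
    extend D σ (TupleChain.of θ) =
      TupleChain.map (TopSimplex.vmap θ) (k + 2) (D (σ.comp (TopSimplex.vmap θ))) := by
  simp [extend]

/-- Naturality: the chosen chain depends only on the restricted singular simplex, not on the simplex
in which it is a face. -/
theorem map_extend {k : ℕ} (D : C(TopSimplex (SimplexCategory.mk k), Y) →
      TupleChain (TopSimplex (SimplexCategory.mk k)) (k + 2)) {m n : ℕ}
    (σ : C(TopSimplex (SimplexCategory.mk n), Y)) (θ : Fin (m + 1) → Fin (n + 1))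
    (z : TupleChain (Fin (m + 1)) (k + 1)) :
    TupleChain.map (TopSimplex.vmap θ) (k + 2) (extend D (σ.comp (TopSimplex.vmap θ)) z) =
      extend D σ (TupleChain.map θ (k + 1) z) := by
  refine LinearMap.congr_fun (f := TupleChain.map (TopSimplex.vmap θ) (k + 2) ∘ₗ
      extend D (σ.comp (TopSimplex.vmap θ))) (g := extend D σ ∘ₗ TupleChain.map θ (k + 1))
    (TupleChain.hom_ext fun v => ?_) z
  simp only [LinearMap.comp_apply, TupleChain.map_of, extend_of, TupleChain.map_map,
    ContinuousMap.comp_assoc, TopSimplex.vmap_vmap]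
  rw [← TopSimplex.vmap_vmap]
  rfl

variable (U V)

open Classical in
/-- For every simplex, a chain which bounds the difference of the simplex and a chain of small
simplices, up to the chains of this kind for its faces. -/
def chain : (n : ℕ) → C(TopSimplex (SimplexCategory.mk n), Y) →
    TupleChain (TopSimplex (SimplexCategory.mk n)) (n + 2)
  | 0 => fun _ => 0
  | n + 1 => fun σ =>
    -- The value 0 on small simplices is essential: cochains defined through `chain` then vanish on
    -- them.
    if h : ¬ IsSmall U V σ ∧ ∃ y, TupleChain.of (TopSimplex.vertices (n + 1)) -
        extend (chain n) σ (TupleChain.boundary (n + 1) (TupleChain.of id)) -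
        TupleChain.boundary (n + 2) y ∈ TupleChain.supported (SmallTuple U V σ)
    then h.2.choose else 0

/-- The operator induced by `chain` in all degrees. -/
def extendChain (k : ℕ) {n : ℕ} (σ : C(TopSimplex (SimplexCategory.mk n), Y)) :
    TupleChain (Fin (n + 1)) k →ₗ[ℂ] TupleChain (TopSimplex (SimplexCategory.mk n)) (k + 1) :=
  match k with
  | 0 => 0
  | k + 1 => extend (chain U V k) σ

variable {U V}

theorem chain_eq_zero {n : ℕ} {σ : C(TopSimplex (SimplexCategory.mk n), Y)}
    (h : IsSmall U V σ) : chain U V n σ = 0 := by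
  cases n with
  | zero => rfl
  | succ n =>
    rw [chain]
    exact dif_neg fun h' => h'.1 h

/-- Induction on the dimension. Once the faces have been treated, the chain left to be subdivided
has small boundary, and `exists_sub_boundary_mem` makes it small up to a boundary. -/
theorem chain_spec (hU : IsOpen U) (hV : IsOpen V) {n : ℕ}
    (σ : C(TopSimplex (SimplexCategory.mk n), Y)) (hσ : ∀ p, σ p ∈ U ∪ V) :
    TupleChain.of (TopSimplex.vertices n) -
        extendChain U V n σ (TupleChain.boundary n (TupleChain.of id)) -
        TupleChain.boundary (n + 1) (chain U V n σ) ∈ TupleChain.supported (SmallTuple U V σ) := by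
  induction n with
  | zero =>
    have : IsSmall U V σ := by
      have h0 := Subsingleton.elim (α := TopSimplex (SimplexCategory.mk 0))
      refine (hσ (TopSimplex.base _)).imp (fun h p => ?_) fun h p => ?_ <;> rwa [h0 p]
    exact fun v _ => this.smallTuple v
  | succ n ih =>
    by_cases hs : IsSmall U V σ
    · exact fun v _ => hs.smallTuple v
    -- The induction hypothesis, pushed forward by vertex maps, holds for all chains of vertices of
    -- the larger simplex.
    have key : ∀ z : TupleChain (Fin (n + 2)) (n + 1),
        TupleChain.map (TopSimplex.vertices (n + 1)) (n + 1) z -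
          extendChain U V n σ (TupleChain.boundary n z) -
          TupleChain.boundary (n + 1) (extendChain U V (n + 1) σ z) ∈
            TupleChain.supported (SmallTuple U V σ) := by
      intro z
      refine TupleChain.map_mem_of_supported (Q := fun _ => True)
        (TupleChain.map (TopSimplex.vertices (n + 1)) (n + 1) -
          extendChain U V n σ ∘ₗ TupleChain.boundary n -
          TupleChain.boundary (n + 1) ∘ₗ extendChain U V (n + 1) σ) _ (fun θ _ => ?_)
        fun _ _ => trivial
      have h := TupleChain.map_mem (R := SmallTuple U V σ) (TopSimplex.vmap θ)
        (fun v hv => SmallTuple.vmap hv) (ih (σ.comp (TopSimplex.vmap θ)) fun p => hσ _)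
      convert h using 1
      simp only [LinearMap.sub_apply, LinearMap.comp_apply, map_sub, TupleChain.map_of,
        TopSimplex.vmap_comp_vertices, ← TupleChain.boundary_map]
      congr 1
      · congr 1
        cases n with
        | zero => simp [extendChain]
        | succ n =>
          simp only [extendChain]
          rw [map_extend, ← TupleChain.boundary_map, TupleChain.map_of]
          rfl
      · simp only [extendChain]
        rw [extend_of]
    have hex : ∃ y, TupleChain.of (TopSimplex.vertices (n + 1)) -
        extend (chain U V n) σ (TupleChain.boundary (n + 1) (TupleChain.of id)) -
        TupleChain.boundary (n + 2) y ∈ TupleChain.supported (SmallTuple U V σ) := by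
      obtain ⟨δ, hδ, hfine⟩ := exists_fine_smallTuple hU hV σ hσ
      refine TupleChain.exists_sub_boundary_mem (convex_stdSimplex ℝ (Fin (n + 2)))
        (fun {k} => SmallTuple U V σ (k := k)) hδ hfine (fun v u hv hu => hv.of_hull hu) ?_
      -- For the boundary of the full tuple the middle term contains ∂∂ = 0; the rest is the
      -- boundary of the chain to be made small.
      have := key (TupleChain.boundary (n + 1) (TupleChain.of id))
      rw [TupleChain.boundary_boundary, map_zero, sub_zero, ← TupleChain.boundary_map,
        ← map_sub, TupleChain.map_of] at this
      exact this
    have h : chain U V (n + 1) σ = hex.choose := by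
      rw [chain]
      exact dif_pos ⟨hs, hex⟩
    rw [h]
    exact hex.choose_spec

end SmallSimplices

/-! ### Cochains that vanish on the simplices in a subset -/

namespace LocalSystem

variable {Y : Type} [TopologicalSpace Y] (L : LocalSystem Y)

/-- The cochains that vanish on all simplices in `A`. -/
def van (n : ℕ) (A : Set Y) : Submodule ℂ (Cochain L (SimplexCategory.mk n)) where
  carrier := {c | ∀ σ : C(TopSimplex (SimplexCategory.mk n), Y), (∀ p, σ p ∈ A) → c σ = 0}
  add_mem' {a b} ha hb σ hσ := by
    have h1 : a σ = 0 := ha σ hσ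
    have h2 : b σ = 0 := hb σ hσ
    rw [Pi.add_apply, h1, h2, add_zero]
  zero_mem' _ _ := rfl
  smul_mem' r c hc σ hσ := by
    have h1 : c σ = 0 := hc σ hσ
    rw [Pi.smul_apply, h1, smul_zero]

variable {L}

theorem van_anti {n : ℕ} {A B : Set Y} (h : A ⊆ B) : L.van n B ≤ L.van n A :=
  fun _ hc σ hσ => hc σ fun p => h (hσ p)

theorem d_mem_van {n : ℕ} {A : Set Y} {c : Cochain L (SimplexCategory.mk n)} (hc : c ∈ L.van n A) :
    L.d n c ∈ L.van (n + 1) A := by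
  intro σ hσ
  rw [d_apply]
  refine Finset.sum_eq_zero fun i _ => ?_
  rw [cochainMap_apply]
  have h : c (σ.comp (TopSimplex.map (SimplexCategory.δ i))) = 0 := hc _ fun p => hσ _
  rw [h, map_zero, smul_zero]

theorem cochainMap_pair {n m : ℕ}
    {c : Cochain L (SimplexCategory.mk n)} (σ : C(TopSimplex (SimplexCategory.mk m), Y))
    (θ : SimplexCategory.mk n ⟶ SimplexCategory.mk m) {l : ℕ}
    {z : TupleChain (TopSimplex (SimplexCategory.mk n)) (l + 1)}
    {e : Cochain L (SimplexCategory.mk l)}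
    (h : c (σ.comp (TopSimplex.map θ)) =
      L.pair (convex_stdSimplex ℝ (Fin (n + 1))) (σ.comp (TopSimplex.map θ))
        (TopSimplex.base _) l z e) :
    cochainMap L θ c σ =
      L.pair (convex_stdSimplex ℝ (Fin (m + 1))) σ (TopSimplex.base _) l
        (TupleChain.map (TopSimplex.map θ) (l + 1) z) e := by
  rw [cochainMap_apply, h, transport_eq_trans, ← pair_map L _ _ _ (TopSimplex.isAffine_map θ),
    trans_pair]

/-- A cocycle on `U ∪ V` that vanishes on small simplices is the coboundary of a cochain that
vanishes on small simplices. -/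
theorem exists_d_eq_of_small {U V : Set Y} (hU : IsOpen U) (hV : IsOpen V) {n : ℕ}
    {c : Cochain L (SimplexCategory.mk (n + 1))} (hc : L.d (n + 1) c ∈ L.van (n + 2) (U ∪ V))
    (hcU : c ∈ L.van (n + 1) U) (hcV : c ∈ L.van (n + 1) V) :
    ∃ b ∈ L.van n U ⊓ L.van n V, c - L.d n b ∈ L.van (n + 1) (U ∪ V) := by
  let b : Cochain L (SimplexCategory.mk n) := fun σ =>
    L.pair (convex_stdSimplex ℝ (Fin (n + 1))) σ (TopSimplex.base _) (n + 1)
      (SmallSimplices.chain U V n σ) c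
  have hb0 : ∀ σ : C(TopSimplex (SimplexCategory.mk n), Y), SmallSimplices.IsSmall U V σ →
      b σ = 0 := by
    intro σ hσ
    simp only [b]
    rw [SmallSimplices.chain_eq_zero hσ, map_zero, LinearMap.zero_apply]
  refine ⟨b, ⟨fun σ hσ => hb0 σ (Or.inl hσ), fun σ hσ => hb0 σ (Or.inr hσ)⟩, fun σ hσ => ?_⟩
  -- The faces of `σ` contribute the values of `c` on the chains chosen for them. By `chain_spec`
  -- this differs from `c σ` by a value on small simplices, which is 0, and by c(∂ chain) =
  -- (dc)(chain) = 0.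
  have hdb : L.d n b σ = L.pair (convex_stdSimplex ℝ (Fin (n + 2))) σ (TopSimplex.base _) (n + 1)
      (SmallSimplices.extendChain U V (n + 1) σ
        (TupleChain.boundary (n + 1) (TupleChain.of id))) c := by
    rw [d_apply, TupleChain.boundary_of, map_sum, map_sum, LinearMap.sum_apply]
    refine Finset.sum_congr rfl fun i _ => ?_
    rw [LinearMap.map_smul, LinearMap.map_smul, LinearMap.smul_apply]
    congr 1
    rw [cochainMap_pair σ (SimplexCategory.δ i) rfl, SmallSimplices.extendChain,
      SmallSimplices.extend_of]
    rfl
  have h := L.pair_eq_zero (convex_stdSimplex ℝ (Fin (n + 2))) σ (TopSimplex.base _) (c := c)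
    (TupleChain.supported_mono (fun v hv => ?_) (SmallSimplices.chain_spec hU hV σ hσ))
  · rw [map_sub, map_sub, LinearMap.sub_apply, LinearMap.sub_apply, ← hdb, pair_vertices,
      ← pair_d] at h
    have h' : L.pair (convex_stdSimplex ℝ (Fin (n + 2))) σ (TopSimplex.base _) (n + 2)
        (SmallSimplices.chain U V (n + 1) σ) (L.d (n + 1) c) = 0 :=
      L.pair_eq_zero _ _ _ fun v _ => hc _ fun p => hσ _
    rw [h', sub_zero] at h
    exact h
  · rcases hv.isSmall with h | h
    · exact hcU _ h
    · exact hcV _ h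

end LocalSystem

namespace LocalSystem

variable {Y : Type} [TopologicalSpace Y] (L : LocalSystem Y)

/-! ### Cocycles and coboundaries on a subset -/

/-- The cochains that are cocycles on `A`. -/
def cocyc (n : ℕ) (A : Set Y) : Submodule ℂ (Cochain L (SimplexCategory.mk n)) :=
  (L.van (n + 1) A).comap (L.d n)

/-- The cochains that are coboundaries on `A`. -/
def cob (A : Set Y) : (n : ℕ) → Submodule ℂ (Cochain L (SimplexCategory.mk n))
  | 0 => L.van 0 A
  | n + 1 => LinearMap.range (L.d n) ⊔ L.van (n + 1) A

variable {L}

theorem van_le_cob {A : Set Y} {n : ℕ} : L.van n A ≤ L.cob A n := by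
  cases n with
  | zero => exact le_rfl
  | succ n => exact le_sup_right

theorem cob_anti {A B : Set Y} (h : A ⊆ B) (n : ℕ) : L.cob B n ≤ L.cob A n := by
  cases n with
  | zero => exact van_anti h
  | succ n => exact sup_le_sup_left (van_anti h) _

theorem cocyc_anti {A B : Set Y} (h : A ⊆ B) (n : ℕ) : L.cocyc n B ≤ L.cocyc n A :=
  fun _ hc => van_anti h hc

theorem mem_cob_succ {A : Set Y} {n : ℕ} {c : Cochain L (SimplexCategory.mk (n + 1))} :
    c ∈ L.cob A (n + 1) ↔ ∃ e, c - L.d n e ∈ L.van (n + 1) A := by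
  constructor
  · intro h
    obtain ⟨_, ⟨e, rfl⟩, w, hw, rfl⟩ := Submodule.mem_sup.1 h
    exact ⟨e, by rwa [add_sub_cancel_left]⟩
  · rintro ⟨e, he⟩
    exact Submodule.mem_sup.2 ⟨_, ⟨e, rfl⟩, _, he, add_sub_cancel _ _⟩

/-- Cochains are defined on the whole space, so a primitive on `A` has a global coboundary.
Replacing `c` by it makes the error vanish exactly on `A`. In degree zero a coboundary on `A`
already vanishes there. -/
theorem exists_of_mem_cob {A : Set Y} {n : ℕ} {c : Cochain L (SimplexCategory.mk n)}
    (hc : c ∈ L.cob A n) :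
    ∃ x, L.d n x = 0 ∧ (∀ B, x ∈ L.cob B n) ∧ c - x ∈ L.van n A := by
  cases n with
  | zero => exact ⟨0, map_zero _, fun B => Submodule.zero_mem _, by rwa [sub_zero]⟩
  | succ n =>
    obtain ⟨e, he⟩ := mem_cob_succ.1 hc
    exact ⟨L.d n e, L.d_d e, fun B => Submodule.mem_sup_left ⟨e, rfl⟩, he⟩

theorem cob_le_cocyc (A : Set Y) (n : ℕ) : L.cob A n ≤ L.cocyc n A := by
  intro c hc
  obtain ⟨x, hx, -, h⟩ := exists_of_mem_cob hc
  have := d_mem_van h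
  rwa [map_sub, hx, sub_zero] at this

/-! ### Mayer–Vietoris -/

/-- Use `c₁` on the simplices in `U` and `c₂` on all others; the two prescriptions conflict only on
simplices in `U ∩ V`. -/
theorem exists_glue_of_van {U V : Set Y} {n : ℕ} {c₁ c₂ : Cochain L (SimplexCategory.mk n)}
    (h : c₁ - c₂ ∈ L.van n (U ∩ V)) : ∃ c, c - c₁ ∈ L.van n U ∧ c - c₂ ∈ L.van n V := by
  classical
  let c : Cochain L (SimplexCategory.mk n) := fun σ => if ∀ p, σ p ∈ U then c₁ σ else c₂ σ
  refine ⟨c, fun σ hσ => ?_, fun σ hσ => ?_⟩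
  · exact sub_eq_zero.2 (if_pos hσ)
  · by_cases hU : ∀ p, σ p ∈ U
    · have h1 : c σ = c₁ σ := if_pos hU
      exact (congrArg (· - c₂ σ) h1).trans (h σ fun p => ⟨hU p, hσ p⟩)
    · exact sub_eq_zero.2 (if_neg hU)

theorem van_zero_union {U V : Set Y} {c : Cochain L (SimplexCategory.mk 0)} (hU : c ∈ L.van 0 U)
    (hV : c ∈ L.van 0 V) : c ∈ L.van 0 (U ∪ V) := by
  intro σ hσ
  have h0 := Subsingleton.elim (α := TopSimplex (SimplexCategory.mk 0))
  rcases hσ (TopSimplex.base _) with h | h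
  · exact hU σ fun p => by rwa [h0 p]
  · exact hV σ fun p => by rwa [h0 p]

theorem mem_cob_union_of_van {U V : Set Y} (hU : IsOpen U) (hV : IsOpen V) {n : ℕ}
    {c : Cochain L (SimplexCategory.mk n)} (hc : c ∈ L.cocyc n (U ∪ V)) (hcU : c ∈ L.van n U)
    (hcV : c ∈ L.van n V) : c ∈ L.cob (U ∪ V) n := by
  cases n with
  | zero => exact van_zero_union hcU hcV
  | succ n =>
    obtain ⟨b, -, hb⟩ := exists_d_eq_of_small hU hV hc hcU hcV
    exact mem_cob_succ.2 ⟨b, hb⟩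

/-- Cocycles on two open sets that are cohomologous on the intersection come from a cocycle on the
union. -/
theorem exists_cocyc_union {U V : Set Y} (hU : IsOpen U) (hV : IsOpen V) {n : ℕ}
    {c₁ c₂ : Cochain L (SimplexCategory.mk n)} (h₁ : c₁ ∈ L.cocyc n U) (h₂ : c₂ ∈ L.cocyc n V)
    (h : c₁ - c₂ ∈ L.cob (U ∩ V) n) :
    ∃ c ∈ L.cocyc n (U ∪ V), c - c₁ ∈ L.cob U n ∧ c - c₂ ∈ L.cob V n := by
  obtain ⟨x, hx, hxc, hxv⟩ := exists_of_mem_cob h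
  rw [sub_sub] at hxv
  obtain ⟨c, hcU, hcV⟩ := exists_glue_of_van hxv
  have hdU : L.d n c ∈ L.van (n + 1) U := by
    have := Submodule.add_mem _ (d_mem_van hcU) h₁
    rwa [← map_add, sub_add_cancel] at this
  have hdV : L.d n c ∈ L.van (n + 1) V := by
    have := Submodule.add_mem _ (d_mem_van hcV) h₂
    rwa [map_sub, map_add, hx, add_zero, sub_add_cancel] at this
  have hdd : L.d (n + 1) (L.d n c) ∈ L.van (n + 2) (U ∪ V) := by
    rw [d_d]
    exact Submodule.zero_mem _
  -- The glued cochain is closed only on small simplices. Its differential on `U ∪ V` is that of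
  -- some `b` vanishing on small simplices, so subtracting `b` closes it without changing it on `U`
  -- or `V`.
  obtain ⟨b, ⟨hbU, hbV⟩, hb⟩ := exists_d_eq_of_small hU hV hdd hdU hdV
  refine ⟨c - b, ?_, ?_, ?_⟩
  · rwa [← map_sub] at hb
  · rw [sub_right_comm]
    exact van_le_cob (Submodule.sub_mem _ hcU hbU)
  · have := Submodule.add_mem _ (van_le_cob (Submodule.sub_mem _ hcV hbV)) (hxc V)
    convert this using 1
    abel

/-- A cocycle on a union of two open sets is a coboundary if it is one on both sets and if the
cocycles on the intersection of one degree less are sums of cocycles on the two sets and a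
coboundary. -/
theorem mem_cob_union {U V : Set Y} (hU : IsOpen U) (hV : IsOpen V) {n : ℕ}
    {c : Cochain L (SimplexCategory.mk n)} (hc : c ∈ L.cocyc n (U ∪ V)) (hcU : c ∈ L.cob U n)
    (hcV : c ∈ L.cob V n)
    (h : ∀ m, n = m + 1 → L.cocyc m (U ∩ V) ≤ L.cocyc m U ⊔ L.cocyc m V ⊔ L.cob (U ∩ V) m) :
    c ∈ L.cob (U ∪ V) n := by
  cases n with
  | zero => exact van_zero_union hcU hcV
  | succ m =>
    obtain ⟨e₁, he₁⟩ := mem_cob_succ.1 hcU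
    obtain ⟨e₂, he₂⟩ := mem_cob_succ.1 hcV
    -- The primitives differ by a cocycle on the intersection. Its decomposition allows them to be
    -- corrected until they agree there and can be glued to `e`.
    have he : e₁ - e₂ ∈ L.cocyc m (U ∩ V) := by
      have := Submodule.sub_mem _ (van_anti Set.inter_subset_right he₂)
        (van_anti Set.inter_subset_left he₁)
      rwa [sub_sub_sub_cancel_left, ← map_sub] at this
    obtain ⟨f, hf, g, hg, hfg⟩ := Submodule.mem_sup.1 (h m rfl he)
    obtain ⟨f₁, hf₁, f₂, hf₂, rfl⟩ := Submodule.mem_sup.1 hf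
    obtain ⟨x, hx, -, hxv⟩ := exists_of_mem_cob hg
    have hv : (e₁ - f₁) - (e₂ + f₂ + x) ∈ L.van m (U ∩ V) := by
      convert hxv using 1
      rw [eq_sub_iff_add_eq.2 ((add_comm g (f₁ + f₂)).trans hfg)]
      abel
    obtain ⟨e, heU, heV⟩ := exists_glue_of_van hv
    have hU' : c - L.d m e ∈ L.van (m + 1) U := by
      have := Submodule.sub_mem _ (Submodule.add_mem _ he₁ hf₁) (d_mem_van heU)
      convert this using 1
      simp only [map_sub]
      abel
    have hV' : c - L.d m e ∈ L.van (m + 1) V := by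
      have := Submodule.sub_mem _ (Submodule.sub_mem _ he₂ hf₂) (d_mem_van heV)
      convert this using 1
      simp only [map_sub, map_add, hx]
      abel
    have hdc : c - L.d m e ∈ L.cocyc (m + 1) (U ∪ V) :=
      Submodule.sub_mem _ hc (cob_le_cocyc _ (m + 1) (Submodule.mem_sup_left ⟨e, rfl⟩))
    have := Submodule.add_mem _ (mem_cob_union_of_van hU hV hdc hU' hV')
      (Submodule.mem_sup_left ⟨e, rfl⟩ : L.d m e ∈ L.cob (U ∪ V) (m + 1))
    rwa [sub_add_cancel] at this

/-! ### Deformations -/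

section Cast

variable {K K' : Type} [TopologicalSpace K] [TopologicalSpace K']

/-- The identification of fibres that comes from the equality `κ ∘ ι = σ`. -/
def castAt (L : LocalSystem Y) {κ : C(K', Y)} {ι : C(K, K')} {σ : C(K, Y)} (h : κ.comp ι = σ)
    (a : K) : L.obj ⟨κ (ι a)⟩ →ₗ[ℂ] L.obj ⟨σ a⟩ :=
  (L.map (eqToHom (congrArg FundamentalGroupoid.mk (DFunLike.congr_fun h a)))).hom

theorem castAt_rfl {κ : C(K', Y)} {ι : C(K, K')} (a : K) (x : L.obj ⟨κ (ι a)⟩) :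
    L.castAt (rfl : κ.comp ι = κ.comp ι) a x = x := by
  simp only [castAt, eqToHom_refl, CategoryTheory.Functor.map_id]
  rfl

theorem trans_castAt [ContractibleSpace K] [ContractibleSpace K'] {κ : C(K', Y)}
    {ι : C(K, K')} {σ : C(K, Y)} (h : κ.comp ι = σ)
    (a b : K) (x : L.obj ⟨κ (ι a)⟩) :
    L.trans σ a b (L.castAt h a x) = L.castAt h b (L.trans κ (ι a) (ι b) x) := by
  subst h
  rw [castAt_rfl, castAt_rfl, trans_comp]

end Cast

theorem castAt_pair_map {E E' : Type} [NormedAddCommGroup E] [NormedSpace ℝ E]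
    [NormedAddCommGroup E'] [NormedSpace ℝ E'] {S : Set E} {S' : Set E'} [ContractibleSpace S]
    [ContractibleSpace S'] (hS : Convex ℝ S) (hS' : Convex ℝ S') {κ : C(S', Y)} {ι : C(S, S')}
    {σ : C(S, Y)} (h : κ.comp ι = σ) (hι : hS.IsAffine hS' ι) (b : S) {m : ℕ}
    (z : TupleChain S (m + 1)) (c : Cochain L (SimplexCategory.mk m)) :
    L.castAt h b (L.pair hS' κ (ι b) m (TupleChain.map ι (m + 1) z) c) = L.pair hS σ b m z c := by
  subst h
  rw [castAt_rfl, pair_map L hS hS' κ hι]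

end LocalSystem

/-! ### The cylinder over a simplex -/

/-- The cylinder over the standard simplex. -/
abbrev simplexCylinder (n : ℕ) : Set ((Fin (n + 1) → ℝ) × ℝ) :=
  stdSimplex ℝ (Fin (n + 1)) ×ˢ Set.Icc 0 1

namespace simplexCylinder

theorem convex (n : ℕ) : Convex ℝ (simplexCylinder n) :=
  (convex_stdSimplex ℝ _).prod (convex_Icc 0 1)

/-- A point of the cylinder. -/
abbrev mk {n : ℕ} (p : TopSimplex (SimplexCategory.mk n)) (t : unitInterval) : simplexCylinder n :=
  ⟨(p.1, t.1), p.2, t.2⟩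

/-- The projection to the simplex. -/
abbrev fst {n : ℕ} (x : simplexCylinder n) : TopSimplex (SimplexCategory.mk n) :=
  ⟨x.1.1, x.2.1⟩

/-- The projection to the interval. -/
abbrev snd {n : ℕ} (x : simplexCylinder n) : unitInterval := ⟨x.1.2, x.2.2⟩

instance (n : ℕ) : ContractibleSpace (simplexCylinder n) :=
  (convex n).contractibleSpace ⟨_, (mk (TopSimplex.base _) 0).2⟩

/-- The inclusion of the simplex at time `t`. -/
def incl (n : ℕ) (t : unitInterval) : C(TopSimplex (SimplexCategory.mk n), simplexCylinder n) where
  toFun p := mk p t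
  continuous_toFun := by fun_prop

theorem isAffine_incl (n : ℕ) (t : unitInterval) :
    (convex_stdSimplex ℝ (Fin (n + 1))).IsAffine (convex n) (incl n t) := by
  intro m v
  ext p : 2
  rw [Convex.simplex_coe]
  refine Prod.ext ?_ ?_
  · rw [Prod.fst_sum]
    rfl
  · rw [Prod.snd_sum]
    change (t : ℝ) = ∑ i : Fin (m + 1), p i • (t : ℝ)
    rw [← Finset.sum_smul, stdSimplex.sum_eq_one, one_smul]

/-- The map of cylinders induced by a map of simplices. -/
def map {m n : ℕ} (θ : SimplexCategory.mk m ⟶ SimplexCategory.mk n) :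
    C(simplexCylinder m, simplexCylinder n) where
  toFun x := mk (TopSimplex.map θ (fst x)) (snd x)
  continuous_toFun := by
    have h : Continuous fun x : simplexCylinder m => TopSimplex.map θ (fst x) :=
      (TopSimplex.map θ).continuous.comp (by fun_prop)
    exact Continuous.subtype_mk ((continuous_subtype_val.comp h).prodMk (by fun_prop)) _

theorem isAffine_map {m n : ℕ} (θ : SimplexCategory.mk m ⟶ SimplexCategory.mk n) :
    (convex m).IsAffine (convex n) (map θ) := by
  intro l v
  ext p : 2
  rw [Convex.simplex_coe]
  have h := DFunLike.congr_fun (TopSimplex.isAffine_map θ (fst ∘ v)) p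
  refine Prod.ext ?_ ?_
  · rw [Prod.fst_sum]
    refine Eq.trans ?_ (congrArg Subtype.val h)
    change ((TopSimplex.map θ (fst ((convex m).simplex v p))) : Fin (n + 1) → ℝ) =
      (TopSimplex.map θ ((convex_stdSimplex ℝ (Fin (m + 1))).simplex (fst ∘ v) p) :
        Fin (n + 1) → ℝ)
    congr 2
    apply Subtype.ext
    change ((convex m).simplex v p : (Fin (m + 1) → ℝ) × ℝ).1 = _
    rw [Convex.simplex_coe, Prod.fst_sum]
    rfl
  · rw [Prod.snd_sum]
    change ((convex m).simplex v p : (Fin (m + 1) → ℝ) × ℝ).2 = _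
    rw [Convex.simplex_coe, Prod.snd_sum]
    rfl

end simplexCylinder

/-! ### The homotopy operator and deformations -/

namespace LocalSystem

variable {Y : Type} [TopologicalSpace Y] {L : LocalSystem Y}

section Homotopy

variable {A : Set Y} (F : C(A × unitInterval, Y)) (hF : ∀ a, F (a, 0) = a)

/-- The homotopy applied to a simplex. -/
def cyl {n : ℕ} (σ : C(TopSimplex (SimplexCategory.mk n), Y)) (hσ : ∀ p, σ p ∈ A) :
    C(simplexCylinder n, Y) where
  toFun x := F (⟨σ (simplexCylinder.fst x), hσ _⟩, simplexCylinder.snd x)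
  continuous_toFun := by
    have h : Continuous fun x : simplexCylinder n => σ (simplexCylinder.fst x) :=
      σ.continuous.comp (by fun_prop)
    exact F.continuous.comp ((Continuous.subtype_mk h _).prodMk (by fun_prop))

theorem cyl_comp_incl (hF : ∀ a, F (a, 0) = a) {n : ℕ} (σ : C(TopSimplex (SimplexCategory.mk n), Y))
    (hσ : ∀ p, σ p ∈ A) : (cyl F σ hσ).comp (simplexCylinder.incl n 0) = σ := by
  ext1 p
  exact hF ⟨σ p, hσ p⟩

open Classical in
/-- The operator on cochains given by a homotopy and a chain in the cylinder. -/
def homotopyOp (L : LocalSystem Y) {n m : ℕ} (z : TupleChain (simplexCylinder n) (m + 1)) :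
    Cochain L (SimplexCategory.mk m) →ₗ[ℂ] Cochain L (SimplexCategory.mk n) :=
  LinearMap.pi fun σ =>
    if hσ : ∀ p, σ p ∈ A then
      -- Values are transported back to time 0, where the homotopy is the inclusion. The operator
      -- therefore stays in `L`, and the pullback of `L` along the end of the homotopy never
      -- appears.
      L.castAt (cyl_comp_incl F hF σ hσ) (TopSimplex.base _) ∘ₗ
        L.pair (simplexCylinder.convex n) (cyl F σ hσ)
          (simplexCylinder.incl n 0 (TopSimplex.base _)) m z
    else 0

theorem homotopyOp_apply {n m : ℕ} (z : TupleChain (simplexCylinder n) (m + 1))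
    (c : Cochain L (SimplexCategory.mk m)) {σ : C(TopSimplex (SimplexCategory.mk n), Y)}
    (hσ : ∀ p, σ p ∈ A) :
    L.homotopyOp F hF z c σ =
      L.castAt (cyl_comp_incl F hF σ hσ) (TopSimplex.base _)
        (L.pair (simplexCylinder.convex n) (cyl F σ hσ)
          (simplexCylinder.incl n 0 (TopSimplex.base _)) m z c) := by
  rw [homotopyOp, LinearMap.pi_apply, dif_pos hσ]
  rfl

theorem cochainMap_homotopyOp {n m l : ℕ} (θ : SimplexCategory.mk n ⟶ SimplexCategory.mk l)
    (z : TupleChain (simplexCylinder n) (m + 1)) (c : Cochain L (SimplexCategory.mk m))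
    {σ : C(TopSimplex (SimplexCategory.mk l), Y)} (hσ : ∀ p, σ p ∈ A) :
    cochainMap L θ (L.homotopyOp F hF z c) σ =
      L.homotopyOp F hF (TupleChain.map (simplexCylinder.map θ) (m + 1) z) c σ := by
  have hσ' : ∀ p, (σ.comp (TopSimplex.map θ)) p ∈ A := fun p => hσ _
  rw [cochainMap_apply, homotopyOp_apply F hF z c hσ', homotopyOp_apply F hF _ c hσ,
    transport_eq_trans]
  have h := L.pair_map (simplexCylinder.convex n) (simplexCylinder.convex l) (cyl F σ hσ)
    (simplexCylinder.isAffine_map θ) (simplexCylinder.incl n 0 (TopSimplex.base _)) z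
  rw [← L.trans_pair (simplexCylinder.convex l) (cyl F σ hσ)
    (simplexCylinder.map θ (simplexCylinder.incl n 0 (TopSimplex.base _))), h]
  exact trans_castAt (cyl_comp_incl F hF σ hσ) (TopSimplex.map θ (TopSimplex.base _))
    (TopSimplex.base _) _

theorem d_homotopyOp {n m : ℕ} (z : TupleChain (simplexCylinder n) (m + 1))
    (c : Cochain L (SimplexCategory.mk m)) {σ : C(TopSimplex (SimplexCategory.mk (n + 1)), Y)}
    (hσ : ∀ p, σ p ∈ A) :
    L.d n (L.homotopyOp F hF z c) σ =
      L.homotopyOp F hF (∑ i : Fin (n + 2), ((-1 : ℂ) ^ (i : ℕ)) •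
        TupleChain.map (simplexCylinder.map (SimplexCategory.δ i)) (m + 1) z) c σ := by
  rw [d_apply, homotopyOp_apply F hF _ c hσ, map_sum, LinearMap.sum_apply, map_sum]
  refine Finset.sum_congr rfl fun i _ => ?_
  rw [cochainMap_homotopyOp F hF _ _ _ hσ, homotopyOp_apply F hF _ c hσ, LinearMap.map_smul,
    LinearMap.smul_apply, LinearMap.map_smul]

theorem homotopyOp_eq_zero {n m : ℕ} {z : TupleChain (simplexCylinder n) (m + 1)}
    {c : Cochain L (SimplexCategory.mk m)} {B C : Set Y} (hc : c ∈ L.van m C)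
    {σ : C(TopSimplex (SimplexCategory.mk n), Y)} (hσ : ∀ p, σ p ∈ A) (hσB : ∀ p, σ p ∈ B)
    (hz : ∀ v ∈ z.support, ∀ p (a : A), (a : Y) ∈ B →
      F (a, simplexCylinder.snd ((simplexCylinder.convex n).simplex v p)) ∈ C) :
    L.homotopyOp F hF z c σ = 0 := by
  rw [homotopyOp_apply F hF z c hσ, pair_eq_zero, map_zero]
  exact fun v hv => hc _ fun p => hz v hv p _ (hσB _)

/-- The top of the cylinder. -/
abbrev topChain (n : ℕ) : TupleChain (simplexCylinder n) (n + 1) :=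
  TupleChain.map (simplexCylinder.incl n 1) (n + 1) (TupleChain.of (TopSimplex.vertices n))

/-- The prism decomposition of the cylinder. -/
abbrev prismChain (n : ℕ) : TupleChain (simplexCylinder n) (n + 2) :=
  TupleChain.prism (simplexCylinder.incl n 0) (simplexCylinder.incl n 1) (n + 1)
    (TupleChain.of (TopSimplex.vertices n))

theorem map_δ_topChain (n : ℕ) :
    ∑ i : Fin (n + 2), ((-1 : ℂ) ^ (i : ℕ)) •
      TupleChain.map (simplexCylinder.map (SimplexCategory.δ i)) (n + 1) (topChain n) =
    TupleChain.boundary (n + 1) (topChain (n + 1)) := by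
  rw [TupleChain.boundary_map, TupleChain.boundary_of, map_sum]
  refine Finset.sum_congr rfl fun i _ => ?_
  rw [LinearMap.map_smul, TupleChain.map_map, TupleChain.map_of, TupleChain.map_of,
    ← TopSimplex.map_δ_comp_vertices]
  rfl

theorem map_δ_prismChain (n : ℕ) :
    ∑ i : Fin (n + 2), ((-1 : ℂ) ^ (i : ℕ)) •
      TupleChain.map (simplexCylinder.map (SimplexCategory.δ i)) (n + 2) (prismChain n) =
    TupleChain.prism (simplexCylinder.incl (n + 1) 0) (simplexCylinder.incl (n + 1) 1) (n + 1)
      (TupleChain.boundary (n + 1) (TupleChain.of (TopSimplex.vertices (n + 1)))) := by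
  rw [TupleChain.boundary_of, map_sum]
  refine Finset.sum_congr rfl fun i _ => ?_
  rw [LinearMap.map_smul, TupleChain.map_prism, ← TopSimplex.map_δ_comp_vertices,
    ← TupleChain.map_of, TupleChain.prism_map]
  rfl

/-- The top of the cylinder gives pullback along the end of the homotopy, followed by transport back
along it; on `A` this commutes with `d`. -/
theorem d_homotopyOp_top {n : ℕ} (c : Cochain L (SimplexCategory.mk n)) :
    L.d n (L.homotopyOp F hF (topChain n) c) -
      L.homotopyOp F hF (topChain (n + 1)) (L.d n c) ∈ L.van (n + 1) A := by
  intro σ hσ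
  rw [Pi.sub_apply, d_homotopyOp F hF _ _ hσ, map_δ_topChain, homotopyOp_apply F hF _ _ hσ,
    homotopyOp_apply F hF _ _ hσ, pair_d, sub_self]

/-- The homotopy formula. -/
theorem homotopyOp_top_sub_mem {B : Set Y} (hBA : B ⊆ A)
    (hB : ∀ (a : A) (t : unitInterval), (a : Y) ∈ B → F (a, t) ∈ B) {n : ℕ}
    {c : Cochain L (SimplexCategory.mk n)} (hc : c ∈ L.cocyc n B) :
    L.homotopyOp F hF (topChain n) c - c ∈ L.cob B n := by
  have key : ∀ σ : C(TopSimplex (SimplexCategory.mk n), Y), (∀ p, σ p ∈ B) →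
      L.homotopyOp F hF (topChain n) c σ - c σ =
        L.homotopyOp F hF (TupleChain.prism (simplexCylinder.incl n 0) (simplexCylinder.incl n 1) n
          (TupleChain.boundary n (TupleChain.of (TopSimplex.vertices n)))) c σ := by
    intro σ hσB
    have hσ : ∀ p, σ p ∈ A := fun p => hBA (hσB p)
    -- The cylinder over a simplex in `B` stays in `B`, where `d c` vanishes. Stokes' formula for
    -- the prism yields top minus bottom minus sides.
    have h0 : L.homotopyOp F hF (prismChain n) (L.d n c) σ = 0 :=
      homotopyOp_eq_zero F hF hc hσ hσB fun v _ p a ha => hB a _ ha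
    have h1 := castAt_pair_map (L := L) (convex_stdSimplex ℝ (Fin (n + 1)))
      (simplexCylinder.convex n) (cyl_comp_incl F hF σ hσ) (simplexCylinder.isAffine_incl n 0)
      (TopSimplex.base _) (TupleChain.of (TopSimplex.vertices n)) c
    rw [pair_vertices] at h1
    rw [homotopyOp_apply F hF _ _ hσ, pair_d, TupleChain.boundary_prism, map_sub, map_sub,
      LinearMap.sub_apply, LinearMap.sub_apply, map_sub, map_sub] at h0
    rw [homotopyOp_apply F hF _ _ hσ, homotopyOp_apply F hF _ _ hσ]
    have h2 := sub_eq_zero.1 h0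
    rw [← h2, ← h1]
  cases n with
  | zero =>
    intro σ hσ
    refine (key σ hσ).trans ?_
    rw [homotopyOp_apply F hF _ _ fun p => hBA (hσ p)]
    simp [TupleChain.prism]
  | succ n =>
    refine mem_cob_succ.2 ⟨L.homotopyOp F hF (prismChain n) c, fun σ hσ => ?_⟩
    have hσA : ∀ p, σ p ∈ A := fun p => hBA (hσ p)
    refine sub_eq_zero.2 ((key σ hσ).trans ?_)
    rw [d_homotopyOp F hF _ _ hσA, map_δ_prismChain]

end Homotopy

/-- The set `A` can be deformed within itself into its subset `B`, such that `B` stays in `B`. -/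
def Deforms (A B : Set Y) : Prop :=
  B ⊆ A ∧ ∃ F : C(A × unitInterval, Y), (∀ a, F (a, 0) = a) ∧ (∀ a t, F (a, t) ∈ A) ∧
    (∀ (a : A) (t : unitInterval), (a : Y) ∈ B → F (a, t) ∈ B) ∧ ∀ a, F (a, 1) ∈ B

section Deforms

variable {A B : Set Y} (F : C(A × unitInterval, Y)) (hF : ∀ a, F (a, 0) = a)

theorem homotopyOp_top_mem_van (hB : ∀ a, F (a, 1) ∈ B) {n : ℕ}
    {c : Cochain L (SimplexCategory.mk n)} (hc : c ∈ L.van n B) :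
    L.homotopyOp F hF (topChain n) c ∈ L.van n A := by
  intro σ hσ
  refine homotopyOp_eq_zero F hF hc hσ hσ fun v hv p a _ => ?_
  have hv' : v = simplexCylinder.incl n 1 ∘ TopSimplex.vertices n := by
    by_contra hne
    rw [topChain, TupleChain.map_of, Finsupp.mem_support_iff, Finsupp.single_apply,
      if_neg (Ne.symm hne)] at hv
    exact hv rfl
  have h1 := DFunLike.congr_fun (simplexCylinder.isAffine_incl n 1 (TopSimplex.vertices n)) p
  rw [hv', ← h1]
  exact hB a

/-- The extension is the pullback of `c` along the end of the deformation, which lands in `B`. -/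
theorem Deforms.exists_cocyc (h : Deforms A B) {n : ℕ} {c : Cochain L (SimplexCategory.mk n)}
    (hc : c ∈ L.cocyc n B) : ∃ c' ∈ L.cocyc n A, c' - c ∈ L.cob B n := by
  obtain ⟨hBA, F, hF, -, hB, h1⟩ := h
  refine ⟨L.homotopyOp F hF (topChain n) c, ?_, homotopyOp_top_sub_mem F hF hBA hB hc⟩
  have := Submodule.add_mem _ (d_homotopyOp_top F hF c) (homotopyOp_top_mem_van F hF h1 hc)
  rwa [sub_add_cancel] at this

/-- On `A` the cocycle is cohomologous to its pullback along the end of the deformation, and this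
pullback turns a primitive on `B` into one on `A`. -/
theorem Deforms.mem_cob (h : Deforms A B) {n : ℕ} {c : Cochain L (SimplexCategory.mk n)}
    (hc : c ∈ L.cocyc n A) (hcB : c ∈ L.cob B n) : c ∈ L.cob A n := by
  obtain ⟨hBA, F, hF, hA, hB, h1⟩ := h
  suffices hT : L.homotopyOp F hF (topChain n) c ∈ L.cob A n by
    have := Submodule.sub_mem _ hT
      (homotopyOp_top_sub_mem F hF subset_rfl (fun a t _ => hA a t) hc)
    rwa [sub_sub_cancel] at this
  cases n with
  | zero => exact homotopyOp_top_mem_van F hF h1 hcB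
  | succ n =>
    obtain ⟨e, he⟩ := mem_cob_succ.1 hcB
    refine mem_cob_succ.2 ⟨L.homotopyOp F hF (topChain n) e, ?_⟩
    have := Submodule.sub_mem _ (homotopyOp_top_mem_van F hF h1 he) (d_homotopyOp_top F hF e)
    convert this using 1
    rw [map_sub]
    abel

end Deforms

end LocalSystem

namespace LocalSystem

variable {Y : Type} [TopologicalSpace Y] {L : LocalSystem Y}

/-! ### Complements of a divisor with a tubular neighbourhood -/

theorem mem_van_empty {n : ℕ} (c : Cochain L (SimplexCategory.mk n)) : c ∈ L.van n ∅ :=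
  fun _ hσ => (hσ (TopSimplex.base _)).elim

/-- A tubular neighbourhood `N` of a closed set `Z`, with two sectors `U` and `V` that cover
`N \ Z` and meet in the disjoint sectors `W₁` and `W₂`. -/
structure IsTube (Z N U V W₁ W₂ : Set Y) : Prop where
  isOpen_nbhd : IsOpen N
  isOpen_compl : IsOpen Zᶜ
  isOpen_left : IsOpen U
  isOpen_right : IsOpen V
  isOpen_inter_left : IsOpen W₁
  isOpen_inter_right : IsOpen W₂
  union_eq : U ∪ V = Zᶜ ∩ N
  inter_eq : U ∩ V = W₁ ∪ W₂
  disjoint : W₁ ∩ W₂ = ∅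
  deforms_core : Deforms N Z
  deforms_left : Deforms N U
  deforms_right : Deforms N V
  deforms_inter_left : Deforms N W₁
  deforms_inter_right : Deforms N W₂

namespace IsTube

variable {Z N U V W₁ W₂ : Set Y}

theorem compl_union (h : IsTube Z N U V W₁ W₂) : Zᶜ ∪ N = Set.univ :=
  Set.eq_univ_of_forall fun x => by
    by_cases hx : x ∈ Z
    · exact Or.inr (h.deforms_core.1 hx)
    · exact Or.inl hx

/-- The cohomology of the punctured tube comes from the tube if the cohomology of the core vanishes
in one degree less. -/
theorem exists_cocyc_nbhd (h : IsTube Z N U V W₁ W₂) {n : ℕ}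
    (hZ : ∀ m, n = m + 1 → L.cocyc m Z ≤ L.cob Z m)
    {c : Cochain L (SimplexCategory.mk n)} (hc : c ∈ L.cocyc n (U ∪ V)) :
    ∃ c' ∈ L.cocyc n N, c' - c ∈ L.cob (U ∪ V) n := by
  have hUN : U ∪ V ⊆ N := h.union_eq ▸ Set.inter_subset_right
  have hW₁ : W₁ ⊆ U ∩ V := h.inter_eq ▸ Set.subset_union_left
  obtain ⟨c₁, hc₁, hU⟩ := h.deforms_left.exists_cocyc (cocyc_anti Set.subset_union_left n hc)
  have hd : c₁ - c ∈ L.cocyc n (U ∪ V) := Submodule.sub_mem _ (cocyc_anti hUN n hc₁) hc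
  have hV : c₁ - c ∈ L.cob V n := by
    -- The difference on `V` is represented by `c₂` on `N`. On `W₁ ⊆ U` it is a coboundary, so `c₂`
    -- is one on `N` because `N` deforms into `W₁`.
    obtain ⟨c₂, hc₂, hV⟩ := h.deforms_right.exists_cocyc (cocyc_anti Set.subset_union_right n hd)
    have h1 : c₂ ∈ L.cob W₁ n := by
      have := Submodule.add_mem _ (cob_anti (hW₁.trans Set.inter_subset_right) n hV)
        (cob_anti (hW₁.trans Set.inter_subset_left) n hU)
      rwa [sub_add_cancel] at this
    have h2 := cob_anti (Set.subset_union_right.trans hUN) n (h.deforms_inter_left.mem_cob hc₂ h1)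
    have := Submodule.sub_mem _ h2 hV
    rwa [sub_sub_cancel] at this
  refine ⟨c₁, hc₁, mem_cob_union h.isOpen_left h.isOpen_right hd hU hV fun m hm e he => ?_⟩
  -- The hypothesis on `Z` passes through `N` to both half-disc families, hence to their disjoint
  -- union `U ∩ V`.
  have hN : L.cocyc m N ≤ L.cob N m := fun x hx =>
    h.deforms_core.mem_cob hx (hZ m hm (cocyc_anti h.deforms_core.1 m hx))
  have hW : ∀ W, Deforms N W → W ⊆ U ∩ V → e ∈ L.cob W m := fun W hNW hWUV => by
    obtain ⟨e', he', hee'⟩ := hNW.exists_cocyc (cocyc_anti hWUV m he)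
    have := Submodule.sub_mem _ (cob_anti hNW.1 m (hN he')) hee'
    rwa [sub_sub_cancel] at this
  refine Submodule.mem_sup_right ?_
  have hW₂ : W₂ ⊆ U ∩ V := h.inter_eq ▸ Set.subset_union_right
  rw [h.inter_eq] at he ⊢
  refine mem_cob_union h.isOpen_inter_left h.isOpen_inter_right he (hW _ h.deforms_inter_left hW₁)
    (hW _ h.deforms_inter_right hW₂) fun k _ x _ => Submodule.mem_sup_right (van_le_cob ?_)
  rw [h.disjoint]
  exact mem_van_empty x

/-- Restriction of cohomology to the complement of `Z` is surjective if the cohomology of `Z`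
vanishes in one degree less. -/
theorem exists_cocyc_univ (h : IsTube Z N U V W₁ W₂) {n : ℕ}
    (hZ : ∀ m, n = m + 1 → L.cocyc m Z ≤ L.cob Z m)
    {c : Cochain L (SimplexCategory.mk n)} (hc : c ∈ L.cocyc n Zᶜ) :
    ∃ c' ∈ L.cocyc n Set.univ, c' - c ∈ L.cob Zᶜ n := by
  obtain ⟨c₂, hc₂, h₂⟩ := h.exists_cocyc_nbhd hZ
    (cocyc_anti (h.union_eq ▸ Set.inter_subset_left) n hc)
  rw [h.union_eq] at h₂
  obtain ⟨c', hc', h', -⟩ := exists_cocyc_union h.isOpen_compl h.isOpen_nbhd hc hc₂ (by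
    have := Submodule.neg_mem _ h₂
    rwa [neg_sub] at this)
  rw [h.compl_union] at hc'
  exact ⟨c', hc', h'⟩

/-- Restriction of first cohomology to the complement of `Z` is injective. -/
theorem mem_cob_univ (h : IsTube Z N U V W₁ W₂)
    {c : Cochain L (SimplexCategory.mk 1)} (hc : c ∈ L.cocyc 1 Set.univ)
    (hcZ : c ∈ L.cob Zᶜ 1) : c ∈ L.cob Set.univ 1 := by
  have hU : U ⊆ Zᶜ := Set.subset_union_left.trans (h.union_eq ▸ Set.inter_subset_left)
  have hN : c ∈ L.cob N 1 :=
    h.deforms_left.mem_cob (cocyc_anti (Set.subset_univ _) 1 hc) (cob_anti hU 1 hcZ)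
  rw [← h.compl_union] at hc ⊢
  refine mem_cob_union h.isOpen_compl h.isOpen_nbhd hc hcZ hN fun m hm e he => ?_
  obtain rfl : m = 0 := by omega
  rw [← h.union_eq] at he ⊢
  -- In degree 0 the condition on the core is vacuous, so sections over the punctured tube extend to
  -- the tube.
  obtain ⟨e', he', hee'⟩ := h.exists_cocyc_nbhd (by omega) he
  have := Submodule.sub_mem _ (Submodule.mem_sup_left (Submodule.mem_sup_right he'))
    (Submodule.mem_sup_right hee' :
      e' - e ∈ L.cocyc 0 Zᶜ ⊔ L.cocyc 0 N ⊔ L.cob (U ∪ V) 0)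
  rwa [sub_sub_cancel] at this

end IsTube

end LocalSystem

/-! ### The tube around a hyperplane in the complement of other hyperplanes -/

namespace HyperplaneTube

variable {E : Type} [NormedAddCommGroup E] [NormedSpace ℂ E] {ι : Type}
  (f : ι → E →L[ℂ] ℂ) (a : ι → ℂ) (f₀ : E →L[ℂ] ℂ) (a₀ : ℂ) (v : E)

/-- The defining function of the central hyperplane. -/
def coord (x : E) : ℂ := f₀ x - a₀

/-- The point over the same point of the central hyperplane as `x` with coordinate `z`. -/
def shift (x : E) (z : ℂ) : E := x + (z - coord f₀ a₀ x) • v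

/-- The absolute value of the `k`-th defining function at the projection of `x`. -/
def height (k : ι) (x : E) : ℝ := ‖f k (shift f₀ a₀ v x 0) - a k‖

/-- The radius of a disc over the projection of `x` that avoids the other hyperplanes. -/
def radius [Fintype ι] (x : E) : ℝ := (1 + ∑ k, ‖f k v‖ / height f a f₀ a₀ v k x)⁻¹

/-- The tube around the central hyperplane. -/
def InTube (x : E) : Prop := ∀ k, ‖f k v‖ * ‖coord f₀ a₀ x‖ < height f a f₀ a₀ v k x

variable {f a f₀ a₀ v}

theorem coord_shift (hv : f₀ v = 1) (x : E) (z : ℂ) : coord f₀ a₀ (shift f₀ a₀ v x z) = z := by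
  simp only [coord, shift, map_add, map_smul, hv, smul_eq_mul]
  ring

theorem shift_shift (hv : f₀ v = 1) (x : E) (z w : ℂ) :
    shift f₀ a₀ v (shift f₀ a₀ v x z) w = shift f₀ a₀ v x w := by
  rw [shift, coord_shift hv, shift, shift]
  module

theorem shift_coord (x : E) : shift f₀ a₀ v x (coord f₀ a₀ x) = x := by
  simp [shift]

theorem height_shift (hv : f₀ v = 1) (k : ι) (x : E) (z : ℂ) :
    height f a f₀ a₀ v k (shift f₀ a₀ v x z) = height f a f₀ a₀ v k x := by
  rw [height, shift_shift hv, height]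

theorem InTube.height_pos {x : E} (hx : InTube f a f₀ a₀ v x) (k : ι) :
    0 < height f a f₀ a₀ v k x :=
  lt_of_le_of_lt (by positivity) (hx k)

theorem inTube_of_coord_eq_zero {x : E} (hx : ∀ k, f k x ≠ a k) (h : coord f₀ a₀ x = 0) :
    InTube f a f₀ a₀ v x := by
  intro k
  have : shift f₀ a₀ v x 0 = x := by rw [← h, shift_coord]
  rw [h, norm_zero, mul_zero, height, this]
  exact norm_pos_iff.2 (sub_ne_zero.2 (hx k))

theorem InTube.radius_pos [Fintype ι] {x : E} (hx : InTube f a f₀ a₀ v x) :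
    0 < radius f a f₀ a₀ v x := by
  have : 0 ≤ ∑ k, ‖f k v‖ / height f a f₀ a₀ v k x :=
    Finset.sum_nonneg fun k _ => div_nonneg (norm_nonneg _) (hx.height_pos k).le
  exact inv_pos.2 (by linarith)

/-- The radius is a continuous substitute for the minimum of the ratios of `height` to `‖f k v‖`.
Adding 1 to the sum makes the inequality strict and avoids a case distinction when `f k v = 0`. -/
theorem InTube.mul_radius_lt [Fintype ι] {x : E} (hx : InTube f a f₀ a₀ v x) (k : ι) :
    ‖f k v‖ * radius f a f₀ a₀ v x < height f a f₀ a₀ v k x := by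
  have h1 : ‖f k v‖ / height f a f₀ a₀ v k x ≤ ∑ k, ‖f k v‖ / height f a f₀ a₀ v k x :=
    Finset.single_le_sum (f := fun k => ‖f k v‖ / height f a f₀ a₀ v k x)
      (fun k _ => div_nonneg (norm_nonneg _) (hx.height_pos k).le) (Finset.mem_univ k)
  have h2 : ‖f k v‖ / height f a f₀ a₀ v k x < (radius f a f₀ a₀ v x)⁻¹ := by
    rw [radius, inv_inv]
    linarith
  rw [div_lt_iff₀ (hx.height_pos k)] at h2
  have h3 := mul_lt_mul_of_pos_right h2 hx.radius_pos
  rwa [mul_right_comm, inv_mul_cancel₀ hx.radius_pos.ne', one_mul] at h3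

theorem InTube.shift (hv : f₀ v = 1) {x : E} {z : ℂ}
    (hz : ∀ k, ‖f k v‖ * ‖z‖ < height f a f₀ a₀ v k x) :
    InTube f a f₀ a₀ v (shift f₀ a₀ v x z) := by
  intro k
  rw [coord_shift hv, height_shift hv]
  exact hz k

/-- On the `k`-th hyperplane `height` equals `‖f k v‖ * ‖coord‖`, which the strict inequality of the
tube forbids. -/
theorem InTube.ne {x : E} (hx : InTube f a f₀ a₀ v x) (k : ι) : f k x ≠ a k := by
  intro h
  have h1 := hx k
  have h2 : f k (HyperplaneTube.shift f₀ a₀ v x 0) - a k = -(coord f₀ a₀ x * f k v) := by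
    rw [HyperplaneTube.shift, map_add, map_smul, h, smul_eq_mul]
    ring
  rw [height, h2, norm_neg, norm_mul, mul_comm] at h1
  exact lt_irrefl _ h1

theorem continuous_coord : Continuous (coord f₀ a₀) :=
  f₀.continuous.sub continuous_const

theorem continuous_height (k : ι) : Continuous (height f a f₀ a₀ v k) :=
  (((f k).continuous.comp (continuous_id.add
    ((continuous_const.sub continuous_coord).smul continuous_const))).sub continuous_const).norm

/-- The part of the tube with coordinate in `C`. -/
def sector (f : ι → E →L[ℂ] ℂ) (a : ι → ℂ) (f₀ : E →L[ℂ] ℂ) (a₀ : ℂ) (v : E) (X : Set E)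
    (C : Set ℂ) : Set X :=
  {x | InTube f a f₀ a₀ v x ∧ coord f₀ a₀ x ∈ C}

theorem isOpen_inTube [Finite ι] : IsOpen {x : E | InTube f a f₀ a₀ v x} := by
  simp only [InTube, Set.ofPred_forall]
  exact isOpen_iInter_of_finite fun k =>
    isOpen_lt (continuous_const.mul continuous_coord.norm) (continuous_height k)

theorem isOpen_sector [Finite ι] (X : Set E) {C : Set ℂ} (hC : IsOpen C) :
    IsOpen (sector f a f₀ a₀ v X C) :=
  (isOpen_inTube.inter (hC.preimage continuous_coord)).preimage continuous_subtype_val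

/-- The tube deforms into its sectors. -/
theorem deforms_sector [Fintype ι] (hv : f₀ v = 1) {X : Set E}
    (hX : ∀ x, (∀ k, f k x ≠ a k) → x ∈ X)
    {C : Set ℂ} {e : ℂ} (he : ‖e‖ ≤ 1)
    (hC : ∀ z ∈ C, ∀ t : unitInterval, ∀ s : ℝ, 0 < s →
      (((1 - t : ℝ) : ℂ) * z + ((t * s : ℝ) : ℂ) * e) ∈ C)
    (hC' : ∀ s : ℝ, 0 < s → (s : ℂ) * e ∈ C) :
    LocalSystem.Deforms (sector f a f₀ a₀ v X Set.univ) (sector f a f₀ a₀ v X C) := by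
  -- Each point moves inside its disc: the coordinate goes straight to the point in direction `e` at
  -- distance `radius * ‖e‖` from the centre. Discs are convex, so the path stays in the tube.
  let z : E × ℝ → ℂ := fun q =>
    ((1 - q.2 : ℝ) : ℂ) * coord f₀ a₀ q.1 + ((q.2 * radius f a f₀ a₀ v q.1 : ℝ) : ℂ) * e
  have hz : ∀ (x : E) (t : unitInterval), InTube f a f₀ a₀ v x →
      InTube f a f₀ a₀ v (shift f₀ a₀ v x (z (x, t))) := by
    intro x t hx
    refine InTube.shift hv fun k => ?_
    have ht0 : (0 : ℝ) ≤ t := t.2.1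
    have ht1 : (0 : ℝ) ≤ 1 - t := sub_nonneg.2 t.2.2
    have h1 : ‖z (x, t)‖ ≤ (1 - t) * ‖coord f₀ a₀ x‖ + t * radius f a f₀ a₀ v x := by
      refine (norm_add_le _ _).trans (add_le_add ?_ ?_)
      · rw [norm_mul, Complex.norm_real, Real.norm_of_nonneg ht1]
      · have h0 := mul_nonneg ht0 hx.radius_pos.le
        rw [norm_mul, Complex.norm_real, Real.norm_of_nonneg h0]
        exact mul_le_of_le_one_right h0 he
    refine (mul_le_mul_of_nonneg_left h1 (norm_nonneg _)).trans_lt ?_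
    have h2 := hx k
    have h3 := hx.mul_radius_lt k
    have h4 : ‖f k v‖ * ((1 - t) * ‖coord f₀ a₀ x‖ + t * radius f a f₀ a₀ v x) =
      (1 - t : ℝ) * (‖f k v‖ * ‖coord f₀ a₀ x‖) + t * (‖f k v‖ * radius f a f₀ a₀ v x) := by ring
    rw [h4]
    rcases ht0.eq_or_lt with ht | ht
    · rw [← ht]
      linarith
    · nlinarith [mul_le_mul_of_nonneg_left h2.le ht1, mul_lt_mul_of_pos_left h3 ht]
  let F : sector f a f₀ a₀ v X Set.univ × unitInterval → X := fun q =>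
    ⟨shift f₀ a₀ v q.1.1.1 (z (q.1.1.1, q.2)), hX _ (hz _ _ q.1.2.1).ne⟩
  have hFc : Continuous F := by
    have hx : Continuous fun q : sector f a f₀ a₀ v X Set.univ × unitInterval => q.1.1.1 := by
      fun_prop
    have ht : Continuous fun q : sector f a f₀ a₀ v X Set.univ × unitInterval => (q.2 : ℝ) := by
      fun_prop
    have hα := (continuous_coord (f₀ := f₀) (a₀ := a₀)).comp hx
    have hr : Continuous fun q : sector f a f₀ a₀ v X Set.univ × unitInterval =>
        radius f a f₀ a₀ v q.1.1.1 := by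
      refine Continuous.inv₀ (continuous_const.add (continuous_finsetSum _ fun k _ => ?_)) ?_
      · exact continuous_const.div ((continuous_height k).comp hx)
          fun q => (q.1.2.1.height_pos k).ne'
      · intro q
        exact (inv_pos.1 q.1.2.1.radius_pos).ne'
    refine Continuous.subtype_mk (hx.add (Continuous.smul (Continuous.sub ?_ hα)
      continuous_const)) _
    exact ((Complex.continuous_ofReal.comp (continuous_const.sub ht)).mul hα).add
      ((Complex.continuous_ofReal.comp (ht.mul hr)).mul continuous_const)
  have hcoord : ∀ q, coord f₀ a₀ (F q) = z (q.1.1.1, q.2) := fun q => coord_shift hv _ _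
  refine ⟨fun x hx => ⟨hx.1, trivial⟩, ⟨F, hFc⟩, fun x => ?_, fun x t => ⟨hz _ _ x.2.1, trivial⟩,
    fun x t hx => ⟨hz _ _ x.2.1, ?_⟩, fun x => ⟨hz _ _ x.2.1, ?_⟩⟩
  · apply Subtype.ext
    change shift f₀ a₀ v x.1.1 (z (x.1.1, (0 : unitInterval))) = x.1.1
    simp [z, shift_coord]
  · change coord f₀ a₀ (F (x, t)) ∈ C
    rw [hcoord]
    exact hC _ hx.2 t _ x.2.1.radius_pos
  · change coord f₀ a₀ (F (x, 1)) ∈ C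
    rw [hcoord]
    simpa [z] using hC' _ x.2.1.radius_pos

/-- All deformations are instances of `deforms_sector`, with directions 0, 1, -1, `I` and `-I` for
the core, the two slit planes and the two half-planes. -/
theorem isTube [Fintype ι] (hv : f₀ v = 1) {X : Set E}
    (hX : ∀ x, x ∈ X ↔ ∀ k, f k x ≠ a k) :
    LocalSystem.IsTube {x : X | coord f₀ a₀ x = 0} (sector f a f₀ a₀ v X Set.univ)
      (sector f a f₀ a₀ v X Complex.slitPlane) (sector f a f₀ a₀ v X {z | -z ∈ Complex.slitPlane})
      (sector f a f₀ a₀ v X {z | 0 < z.im}) (sector f a f₀ a₀ v X {z | z.im < 0}) := by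
  have hX' := fun x => (hX x).2
  have hcoord : Continuous fun x : X => coord f₀ a₀ x :=
    continuous_coord.comp continuous_subtype_val
  have slit : ∀ z ∈ Complex.slitPlane, ∀ t : unitInterval, ∀ s : ℝ, 0 < s →
      (((1 - t : ℝ) : ℂ) * z + ((t * s : ℝ) : ℂ)) ∈ Complex.slitPlane := by
    intro z hz t s hs
    have ht0 : (0 : ℝ) ≤ t := t.2.1
    have ht1 : (t : ℝ) ≤ 1 := t.2.2
    rw [Complex.mem_slitPlane_iff] at hz ⊢
    simp only [Complex.add_re, Complex.add_im, Complex.re_ofReal_mul, Complex.im_ofReal_mul,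
      Complex.ofReal_re, Complex.ofReal_im, add_zero]
    rcases ht1.eq_or_lt with h | h
    · left
      rw [h]
      linarith
    · rcases hz with hz | hz
      · left
        have := mul_pos (sub_pos.2 h) hz
        have := mul_nonneg ht0 hs.le
        linarith
      · right
        exact mul_ne_zero (sub_pos.2 h).ne' hz
  have half : ∀ y : ℝ, 0 < y → ∀ t : unitInterval, ∀ s : ℝ, 0 < s → 0 < (1 - t) * y + t * s := by
    intro y hy t s hs
    have ht0 : (0 : ℝ) ≤ t := t.2.1
    have ht1 : (t : ℝ) ≤ 1 := t.2.2
    rcases ht1.eq_or_lt with h | h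
    · rw [h]
      linarith
    · have := mul_pos (sub_pos.2 h) hy
      have := mul_nonneg ht0 hs.le
      linarith
  have hZ : {x : X | coord f₀ a₀ x = 0} = sector f a f₀ a₀ v X {0} := by
    ext x
    exact ⟨fun h => ⟨inTube_of_coord_eq_zero ((hX x).1 x.2) h, h⟩, fun h => h.2⟩
  refine
    { isOpen_nbhd := isOpen_sector X isOpen_univ
      isOpen_compl := isOpen_ne_fun hcoord continuous_const
      isOpen_left := isOpen_sector X Complex.isOpen_slitPlane
      isOpen_right := isOpen_sector X (Complex.isOpen_slitPlane.preimage continuous_neg)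
      isOpen_inter_left := isOpen_sector X (isOpen_lt continuous_const Complex.continuous_im)
      isOpen_inter_right := isOpen_sector X (isOpen_lt Complex.continuous_im continuous_const)
      union_eq := ?_
      inter_eq := ?_
      disjoint := ?_
      deforms_core := ?_
      deforms_left := ?_
      deforms_right := ?_
      deforms_inter_left := ?_
      deforms_inter_right := ?_ }
  · ext x
    have key : ∀ z : ℂ, z ∈ Complex.slitPlane ∨ -z ∈ Complex.slitPlane ↔ z ≠ 0 := by
      intro z
      simp only [Complex.mem_slitPlane_iff, Complex.neg_re, Complex.neg_im, ne_eq, neg_eq_zero,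
        Complex.ext_iff, Complex.zero_re, Complex.zero_im]
      rcases lt_trichotomy z.re 0 with h | h | h
      · simp [h, h.ne]
      · simp [h]
      · simp [h, h.ne']
    have := key (coord f₀ a₀ x)
    simp only [sector, Set.mem_union, Set.mem_inter_iff, Set.mem_compl_iff, Set.mem_ofPred_eq,
      Set.mem_univ, and_true]
    tauto
  · ext x
    have key : ∀ z : ℂ, z ∈ Complex.slitPlane ∧ -z ∈ Complex.slitPlane ↔ 0 < z.im ∨ z.im < 0 := by
      intro z
      simp only [Complex.mem_slitPlane_iff, Complex.neg_re, Complex.neg_im, ne_eq, neg_eq_zero]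
      rw [← ne_iff_gt_or_lt]
      constructor
      · rintro ⟨h | h, h' | h'⟩
        · linarith
        all_goals assumption
      · exact fun h => ⟨Or.inr h, Or.inr h⟩
    have := key (coord f₀ a₀ x)
    simp only [sector, Set.mem_union, Set.mem_inter_iff, Set.mem_ofPred_eq]
    tauto
  · ext x
    simp only [sector, Set.mem_inter_iff, Set.mem_ofPred_eq, Set.mem_empty_iff_false, iff_false]
    rintro ⟨⟨-, h⟩, -, h'⟩
    exact lt_asymm h h'
  · rw [hZ]
    refine deforms_sector hv hX' (e := 0) (by simp) (fun z hz t s _ => ?_) fun s _ => ?_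
    · rw [Set.mem_singleton_iff.1 hz]
      simp
    · simp
  · refine deforms_sector hv hX' (e := 1) (by simp) (fun z hz t s hs => ?_) fun s hs => ?_
    · rw [mul_one]
      exact slit z hz t s hs
    · rw [mul_one, Complex.ofReal_mem_slitPlane]
      exact hs
  · refine deforms_sector hv hX' (e := -1) (by simp) (fun z hz t s hs => ?_) fun s hs => ?_
    · have := slit _ hz t s hs
      rw [Set.mem_ofPred_eq]
      convert this using 1
      ring
    · rw [Set.mem_ofPred_eq, mul_neg_one, neg_neg, Complex.ofReal_mem_slitPlane]
      exact hs
  · refine deforms_sector hv hX' (e := Complex.I) (by simp) (fun z hz t s hs => ?_)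
      fun s hs => ?_
    · simpa using half _ hz t s hs
    · simpa using hs
  · refine deforms_sector hv hX' (e := -Complex.I) (by simp) (fun z hz t s hs => ?_)
      fun s hs => ?_
    · have := half (-z.im) (neg_pos.2 hz) t s hs
      rw [Set.mem_ofPred_eq]
      simp
      linarith
    · simpa using hs

end HyperplaneTube

namespace LocalSystem

variable {X Y : Type} [TopologicalSpace X] [TopologicalSpace Y]

/-! ### Cohomology in terms of cocycles and coboundaries -/

theorem cochainComplex_d_apply (L : LocalSystem X) (n : ℕ) (c : Cochain L (SimplexCategory.mk n)) :
    ((cochainComplex L).d n (n + 1)).hom c = L.d n c := by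
  rw [cochainComplex_d]
  rfl

theorem eq_zero_of_mem_van_univ {L : LocalSystem X} {n : ℕ}
    {c : Cochain L (SimplexCategory.mk n)} (h : c ∈ L.van n Set.univ) : c = 0 :=
  funext fun σ => h σ fun _ => trivial

theorem mem_cocyc_univ {L : LocalSystem X} {n : ℕ} {c : Cochain L (SimplexCategory.mk n)} :
    c ∈ L.cocyc n Set.univ ↔ L.d n c = 0 :=
  ⟨fun h => eq_zero_of_mem_van_univ h, fun h => by
    rw [cocyc, Submodule.mem_comap, h]
    exact Submodule.zero_mem _⟩

theorem mem_cob_univ {L : LocalSystem X} {n : ℕ} {c : Cochain L (SimplexCategory.mk n)} :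
    c ∈ L.cob Set.univ n ↔
      ∃ b : (cochainComplex L).X ((ComplexShape.up ℕ).prev n),
        ((cochainComplex L).d ((ComplexShape.up ℕ).prev n) n).hom b = c := by
  cases n with
  | zero =>
    -- In degree zero the predecessor is a junk index with zero differential, so only 0 is a
    -- coboundary.
    rw [(cochainComplex L).shape _ _ (by simp)]
    constructor
    · exact fun h => ⟨0, (eq_zero_of_mem_van_univ h).symm⟩
    · rintro ⟨b, rfl⟩
      exact Submodule.zero_mem (L.van 0 Set.univ)
  | succ n =>
    rw [CochainComplex.prev_nat_succ, mem_cob_succ]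
    constructor
    · rintro ⟨e, he⟩
      refine ⟨e, ?_⟩
      rw [cochainComplex_d_apply]
      exact (sub_eq_zero.1 (eq_zero_of_mem_van_univ he)).symm
    · rintro ⟨e, he⟩
      obtain rfl := (cochainComplex_d_apply L n e).symm.trans he
      refine ⟨e, ?_⟩
      rw [sub_self]
      exact Submodule.zero_mem _

theorem isZero_cohomology_iff (L : LocalSystem X) (n : ℕ) :
    Limits.IsZero (L.cohomology n) ↔ L.cocyc n Set.univ ≤ L.cob Set.univ n := by
  change Limits.IsZero ((cochainComplex L).homology n) ↔ _
  rw [← HomologicalComplex.exactAt_iff_isZero_homology,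
    (cochainComplex L).exactAt_iff' _ n (n + 1) rfl (CochainComplex.next _ _),
    ShortComplex.moduleCat_exact_iff]
  constructor
  · intro h c hc
    exact mem_cob_univ.2 (h c ((cochainComplex_d_apply L n c).trans (mem_cocyc_univ.1 hc)))
  · intro h c hc
    exact mem_cob_univ.1 (h (mem_cocyc_univ.2 ((cochainComplex_d_apply L n c).symm.trans hc)))

/-! ### Restriction to a subspace -/

variable (g : C(X, Y)) (L : LocalSystem Y)

/-- The restriction of cochains. -/
def restr (n : ℕ) : Cochain L (SimplexCategory.mk n) →ₗ[ℂ]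
    Cochain (L.pullback g) (SimplexCategory.mk n) :=
  ((cosimplicialRestriction g L).app (SimplexCategory.mk n)).hom

theorem d_restr {n : ℕ} (c : Cochain L (SimplexCategory.mk n)) :
    (L.pullback g).d n (restr g L n c) = restr g L (n + 1) (L.d n c) := by
  have h := (cochainRestriction g L).comm n (n + 1)
  rw [cochainComplex_d, cochainComplex_d] at h
  exact LinearMap.congr_fun (congrArg ModuleCat.Hom.hom h) c

variable {g}

/-- Extend by zero to the simplices that do not factor through `g`; factorizations are unique
because `g` is injective. -/
theorem restr_surjective (hg : Topology.IsEmbedding g) (n : ℕ) :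
    Function.Surjective (restr g L n) := by
  classical
  intro c
  have hinj : ∀ σ τ : C(TopSimplex (SimplexCategory.mk n), X), g.comp σ = g.comp τ → σ = τ :=
    fun σ τ h => ContinuousMap.ext fun p => hg.injective (DFunLike.congr_fun h p)
  let c' : Cochain L (SimplexCategory.mk n) := fun τ =>
    if h : ∃ σ : C(TopSimplex (SimplexCategory.mk n), X), g.comp σ = τ then
      cast (congrArg (fun τ : C(TopSimplex (SimplexCategory.mk n), Y) =>
        (L.obj ⟨τ (TopSimplex.base _)⟩ : Type)) h.choose_spec) (c h.choose)
    else 0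
  refine ⟨c', funext fun σ => ?_⟩
  have h : ∃ σ' : C(TopSimplex (SimplexCategory.mk n), X), g.comp σ' = g.comp σ := ⟨σ, rfl⟩
  have h1 : c' (g.comp σ) = _ := dif_pos h
  exact h1.trans (eq_of_heq ((cast_heq _ _).trans
    (congr_arg_heq c (hinj _ _ h.choose_spec))))

/-- A simplex in the image of an embedding lifts continuously, so simplices of `X` are the simplices
of `Y` in the range. -/
theorem restr_mem_van_univ (hg : Topology.IsEmbedding g) {n : ℕ}
    {c : Cochain L (SimplexCategory.mk n)} :
    restr g L n c ∈ (L.pullback g).van n Set.univ ↔ c ∈ L.van n (Set.range g) := by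
  constructor
  · intro h τ hτ
    choose s hs using hτ
    have hsc : Continuous s := by
      rw [hg.continuous_iff]
      convert τ.continuous using 1
      exact funext hs
    obtain rfl : g.comp ⟨s, hsc⟩ = τ := ContinuousMap.ext hs
    exact h ⟨s, hsc⟩ fun _ => trivial
  · exact fun h σ _ => h _ fun p => ⟨σ p, rfl⟩

theorem restr_mem_cocyc_univ (hg : Topology.IsEmbedding g) {n : ℕ}
    {c : Cochain L (SimplexCategory.mk n)} :
    restr g L n c ∈ (L.pullback g).cocyc n Set.univ ↔ c ∈ L.cocyc n (Set.range g) := by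
  rw [cocyc, Submodule.mem_comap, d_restr, restr_mem_van_univ L hg]
  rfl

theorem restr_mem_cob_univ (hg : Topology.IsEmbedding g) {n : ℕ}
    {c : Cochain L (SimplexCategory.mk n)} :
    restr g L n c ∈ (L.pullback g).cob Set.univ n ↔ c ∈ L.cob (Set.range g) n := by
  cases n with
  | zero => exact restr_mem_van_univ L hg
  | succ n =>
    rw [mem_cob_succ, mem_cob_succ, (restr_surjective L hg n).exists]
    refine exists_congr fun e => ?_
    rw [d_restr, ← map_sub, restr_mem_van_univ L hg]

theorem isZero_cohomology_pullback_iff (hg : Topology.IsEmbedding g) (n : ℕ) :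
    Limits.IsZero ((L.pullback g).cohomology n) ↔
      L.cocyc n (Set.range g) ≤ L.cob (Set.range g) n := by
  rw [isZero_cohomology_iff]
  constructor
  · exact fun h c hc => (restr_mem_cob_univ L hg).1 (h ((restr_mem_cocyc_univ L hg).2 hc))
  · intro h c hc
    obtain ⟨c, rfl⟩ := restr_surjective L hg n c
    exact (restr_mem_cob_univ L hg).2 (h ((restr_mem_cocyc_univ L hg).1 hc))

/-! ### Injectivity and surjectivity of restriction on cohomology -/

/-- The free module on the elements of a module. -/
def freeCover (A : ModuleCat.{0} ℂ) : ModuleCat.{0} ℂ := ModuleCat.of ℂ (A →₀ ℂ)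

/-- The map from the free module given by a family of elements. -/
def freeLift {A B : ModuleCat.{0} ℂ} (s : A → B) : freeCover A ⟶ B :=
  ModuleCat.ofHom (Finsupp.linearCombination ℂ s)

theorem freeLift_single {A B : ModuleCat.{0} ℂ} (s : A → B) (a : A) :
    (freeLift s).hom (Finsupp.single a 1 : A →₀ ℂ) = s a :=
  (Finsupp.linearCombination_single ℂ (1 : ℂ) a).trans (one_smul ℂ (s a))

theorem freeCover_hom_ext {A B : ModuleCat.{0} ℂ} {p q : freeCover A ⟶ B}
    (h : ∀ a, p.hom (Finsupp.single a 1 : A →₀ ℂ) = q.hom (Finsupp.single a 1 : A →₀ ℂ)) :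
    p = q :=
  ModuleCat.hom_ext (Finsupp.lhom_ext' fun a => LinearMap.ext_ring (h a))

instance (A : ModuleCat.{0} ℂ) : Epi (freeLift (id : A → A)) :=
  (ModuleCat.epi_iff_surjective _).2 fun a => ⟨_, freeLift_single id a⟩

theorem mono_restriction (hg : Topology.IsEmbedding g) (n : ℕ)
    (h : ∀ c ∈ L.cocyc n Set.univ, c ∈ L.cob (Set.range g) n → c ∈ L.cob Set.univ n) :
    Mono (HomologicalComplex.homologyMap (cochainRestriction g L) n) := by
  rw [HomologicalComplex.mono_homologyMap_iff_up_to_refinements _ _ n (n + 1) rfl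
    (CochainComplex.next _ _)]
  intro A x hx y hxy
  have key : ∀ a : A, ∃ b : (cochainComplex L).X ((ComplexShape.up ℕ).prev n),
      ((cochainComplex L).d ((ComplexShape.up ℕ).prev n) n).hom b = x.hom a := by
    intro a
    refine mem_cob_univ.1 (h _ (mem_cocyc_univ.2 ?_) ((restr_mem_cob_univ L hg).1
      (mem_cob_univ.2 ⟨y.hom a, ?_⟩)))
    · exact (cochainComplex_d_apply L n _).symm.trans
        (LinearMap.congr_fun (congrArg ModuleCat.Hom.hom hx) a)
    · exact (LinearMap.congr_fun (congrArg ModuleCat.Hom.hom hxy) a).symm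
  choose s hs using key
  -- The chosen primitives need not depend linearly on `a`. They become linear after refining `A` by
  -- the free module on its elements.
  refine ⟨freeCover A, freeLift id, inferInstance, freeLift s, freeCover_hom_ext fun a => ?_⟩
  refine (congrArg x.hom (freeLift_single id a)).trans ((hs a).symm.trans ?_)
  exact congrArg _ (freeLift_single s a).symm

theorem epi_restriction (hg : Topology.IsEmbedding g) (n : ℕ)
    (h : ∀ c ∈ L.cocyc n (Set.range g),
      ∃ c' ∈ L.cocyc n Set.univ, c' - c ∈ L.cob (Set.range g) n) :
    Epi (HomologicalComplex.homologyMap (cochainRestriction g L) n) := by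
  rw [HomologicalComplex.epi_homologyMap_iff_up_to_refinements _ _ n (n + 1) rfl
    (CochainComplex.next _ _)]
  intro A y hy
  have key : ∀ a : A, ∃ (x : (cochainComplex L).X n)
      (b : (cochainComplex (L.pullback g)).X ((ComplexShape.up ℕ).prev n)),
      ((cochainComplex L).d n (n + 1)).hom x = 0 ∧
      y.hom a = ((cochainRestriction g L).f n).hom x +
        ((cochainComplex (L.pullback g)).d ((ComplexShape.up ℕ).prev n) n).hom b := by
    intro a
    obtain ⟨c, hc⟩ := restr_surjective L hg n (y.hom a)
    have hyc : restr g L n c ∈ (L.pullback g).cocyc n Set.univ :=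
      mem_cocyc_univ.2 ((congrArg _ hc).trans ((cochainComplex_d_apply _ n _).symm.trans
        (LinearMap.congr_fun (congrArg ModuleCat.Hom.hom hy) a)))
    obtain ⟨c', hc', hcc'⟩ := h c ((restr_mem_cocyc_univ L hg).1 hyc)
    obtain ⟨b, hb⟩ := mem_cob_univ.1 ((restr_mem_cob_univ L hg).2 hcc')
    refine ⟨c', -b, (cochainComplex_d_apply L n c').trans (mem_cocyc_univ.1 hc'), ?_⟩
    rw [map_neg, hb, ← hc]
    change _ = restr g L n c' + -restr g L n (c' - c)
    rw [map_sub, neg_sub, add_sub_cancel]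
  choose s t hs hst using key
  refine ⟨freeCover A, freeLift id, inferInstance, freeLift s, freeCover_hom_ext fun a => ?_,
    freeLift t, freeCover_hom_ext fun a => ?_⟩
  · exact (congrArg _ (freeLift_single s a)).trans (hs a)
  · refine (congrArg y.hom (freeLift_single id a)).trans ((hst a).trans ?_)
    exact congrArg₂ (· + ·) (congrArg _ (freeLift_single s a).symm)
      (congrArg _ (freeLift_single t a).symm)

/-! ### Degree zero -/

section Zero

variable {L : LocalSystem X}

/-- The value of a `0`-cochain at a point. -/
def value (c : Cochain L (SimplexCategory.mk 0)) (x : X) : L.obj ⟨x⟩ :=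
  c (ContinuousMap.const _ x)

theorem eq_zero_of_value {c : Cochain L (SimplexCategory.mk 0)} (h : ∀ x, value c x = 0) :
    c = 0 := by
  funext σ
  have h0 := Subsingleton.elim (α := TopSimplex (SimplexCategory.mk 0))
  obtain ⟨x, rfl⟩ : ∃ x, ContinuousMap.const _ x = σ :=
    ⟨σ (TopSimplex.base _), ContinuousMap.ext fun p => by
      rw [h0 p (TopSimplex.base _)]
      rfl⟩
  exact h x

/-- A 0-cocycle is a parallel section: Stokes' formula on the unit interval, mapped to the space by
the path itself, compares the two end values. -/
theorem map_value {c : Cochain L (SimplexCategory.mk 0)} (hc : L.d 0 c = 0)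
    {x y : FundamentalGroupoid X} (p : x ⟶ y) :
    (L.map p).hom (value c x.as) = value c y.as := by
  obtain ⟨x⟩ := x
  obtain ⟨y⟩ := y
  obtain ⟨γ, rfl⟩ := Quotient.exists_rep p
  obtain ⟨κ, h0, h1⟩ := γ
  obtain rfl : κ 0 = x := h0
  obtain rfl : κ 1 = y := h1
  have hI : Convex ℝ (Set.Icc (0 : ℝ) 1) := convex_Icc 0 1
  have : ContractibleSpace (Set.Icc (0 : ℝ) 1) := hI.contractibleSpace ⟨0, by simp⟩
  have hev : ∀ a b : unitInterval, L.pair hI κ b 0 (TupleChain.of fun _ => a) c =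
      L.trans κ a b (value c (κ a)) := by
    intro a b
    have h : hI.simplex (m := 0) (fun _ => a) = ContinuousMap.const _ a := by
      ext t
      rw [Convex.simplex_coe, ← Finset.sum_smul, stdSimplex.sum_eq_one, one_smul]
      rfl
    rw [pair_of, h]
    rfl
  let v : Fin 2 → unitInterval := ![0, 1]
  have hp := L.pair_d hI κ 1 (TupleChain.of v) c
  have hb : TupleChain.boundary 1 (TupleChain.of v) =
      TupleChain.of (fun _ : Fin 1 => (1 : unitInterval)) -
        TupleChain.of (fun _ : Fin 1 => (0 : unitInterval)) := by
    rw [TupleChain.boundary_of, Fin.sum_univ_two]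
    have h0 : v ∘ Fin.succAbove 0 = fun _ : Fin 1 => (1 : unitInterval) := by
      funext i
      fin_cases i
      rfl
    have h1 : v ∘ Fin.succAbove 1 = fun _ : Fin 1 => (0 : unitInterval) := by
      funext i
      fin_cases i
      rfl
    rw [h0, h1]
    simp only [Fin.val_zero, Fin.val_one, pow_zero, pow_one, one_smul, neg_smul, ← sub_eq_add_neg]
  rw [hc, map_zero, hb, map_sub, LinearMap.sub_apply, hev, hev, trans_self, eq_comm,
    sub_eq_zero] at hp
  rw [hp]
  let e : Path (0 : unitInterval) 1 := ⟨ContinuousMap.id _, rfl, rfl⟩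
  have := L.trans_eq κ (FundamentalGroupoid.fromPath (Path.Homotopic.Quotient.mk e))
  rw [this]
  rfl

/-- A non-trivial local system of rank one on a path connected space has no global sections. -/
theorem cocyc_zero_le_cob (hX : ∀ x y : X, Joined x y) (hL : L.IsRankOne)
    (hnt : ¬ L.IsTrivial) :
    L.cocyc 0 Set.univ ≤ L.cob Set.univ 0 := by
  intro c hc
  have hc0 := mem_cocyc_univ.1 hc
  suffices c = 0 by
    rw [this]
    exact Submodule.zero_mem _
  by_contra hne
  obtain ⟨x, hx⟩ : ∃ x, value c x ≠ 0 := by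
    by_contra! h
    exact hne (eq_zero_of_value h)
  have hv : ∀ y : FundamentalGroupoid X, value c y.as ≠ 0 := by
    intro y hy
    let p : y ⟶ FundamentalGroupoid.mk x :=
      FundamentalGroupoid.fromPath (Path.Homotopic.Quotient.mk (hX y.as x).somePath)
    have := map_value hc0 p
    rw [hy, map_zero] at this
    exact hx this.symm
  -- A parallel section that is nonzero at one point is nonzero everywhere, hence spans every fibre
  -- and trivializes the system.
  let e : ∀ y : FundamentalGroupoid X, ℂ →ₗ[ℂ] L.obj y := fun y =>
    LinearMap.toSpanSingleton ℂ (L.obj y) (value c y.as)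
  have he : ∀ y, Function.Bijective (e y) := by
    intro y
    refine ⟨fun a b hab => smul_left_injective ℂ (hv y) hab, fun z => ?_⟩
    exact (finrank_eq_one_iff_of_nonzero' _ (hv y)).1 (hL y) z
  refine hnt ⟨(NatIso.ofComponents
    (fun y => (LinearEquiv.ofBijective (e y) (he y)).toModuleIso) fun {y z} p => ?_).symm⟩
  apply ModuleCat.hom_ext
  refine LinearMap.ext_ring ?_
  change e z 1 = (L.map p).hom (e y 1)
  simp only [e, LinearMap.toSpanSingleton_apply, one_smul]
  exact (map_value hc0 p).symm

end Zero

end LocalSystem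

/-! ### Hyperplane arrangements -/

/-- A hyperplane is the zero set of an affine function. -/
theorem IsHyperplane.exists_eq {ℓ : ℕ} {K : AffineSubspace ℂ (EuclideanSpace ℂ (Fin ℓ))}
    (hK : IsHyperplane K) :
    ∃ (f : EuclideanSpace ℂ (Fin ℓ) →L[ℂ] ℂ) (a : ℂ) (v : EuclideanSpace ℂ (Fin ℓ)),
      f v = 1 ∧ ∀ x, x ∈ K ↔ f x = a := by
  obtain ⟨p, hp⟩ := hK.nonempty
  have : FiniteDimensional ℂ (EuclideanSpace ℂ (Fin ℓ) ⧸ K.direction) :=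
    FiniteDimensional.of_finrank_eq_succ hK.codim_one
  let e : (EuclideanSpace ℂ (Fin ℓ) ⧸ K.direction) ≃ₗ[ℂ] ℂ :=
    LinearEquiv.ofFinrankEq _ _ (hK.codim_one.trans (Module.finrank_self ℂ).symm)
  let f : EuclideanSpace ℂ (Fin ℓ) →ₗ[ℂ] ℂ := e.toLinearMap ∘ₗ K.direction.mkQ
  obtain ⟨v, hv⟩ : ∃ v, f v = 1 :=
    (e.surjective.comp (Submodule.mkQ_surjective _)) 1
  refine ⟨LinearMap.toContinuousLinearMap f, f p, v, hv, fun x => ?_⟩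
  have h1 : x ∈ K ↔ x - p ∈ K.direction := by
    rw [← AffineSubspace.vadd_mem_iff_mem_direction (x - p) hp, vadd_eq_add, sub_add_cancel]
  have h2 : f (x - p) = 0 ↔ x - p ∈ K.direction := by
    change e (K.direction.mkQ (x - p)) = 0 ↔ _
    rw [LinearEquiv.map_eq_zero_iff, Submodule.mkQ_apply, Submodule.Quotient.mk_eq_zero]
  rw [h1, ← h2, map_sub, sub_eq_zero]
  rfl

namespace HyperplaneArrangement

variable {ℓ : ℕ} (A : HyperplaneArrangement (EuclideanSpace ℂ (Fin ℓ)) (EuclideanSpace ℂ (Fin ℓ)))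
  (H : A.hyperplanes)

theorem isEmbedding_inclDeletion : Topology.IsEmbedding (A.inclDeletion H) := by
  have h : (Subtype.val : (A.deletion H).complement → _) ∘ A.inclDeletion H = Subtype.val := rfl
  refine Topology.IsEmbedding.of_comp (A.inclDeletion H).continuous continuous_subtype_val ?_
  rw [h]
  exact Topology.IsEmbedding.subtypeVal

theorem isEmbedding_inclRestriction : Topology.IsEmbedding (A.inclRestriction H) := by
  have h : (Subtype.val : (A.deletion H).complement → _) ∘ A.inclRestriction H =
    Subtype.val ∘ Subtype.val := rfl
  refine Topology.IsEmbedding.of_comp (A.inclRestriction H).continuous continuous_subtype_val ?_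
  rw [h]
  exact Topology.IsEmbedding.subtypeVal.comp Topology.IsEmbedding.subtypeVal

theorem range_inclDeletion :
    Set.range (A.inclDeletion H) =
      {x : (A.deletion H).complement | x.1 ∉ (H : AffineSubspace ℂ _)} := by
  ext x
  constructor
  · rintro ⟨y, rfl⟩
    exact y.2 _ H.2
  · intro hx
    refine ⟨⟨x, fun K hK => ?_⟩, rfl⟩
    by_cases hKH : K = H
    · rw [hKH]
      exact hx
    · exact x.2 K ⟨hK, hKH⟩

theorem range_inclRestriction :
    Set.range (A.inclRestriction H) =
      {x : (A.deletion H).complement | x.1 ∈ (H : AffineSubspace ℂ _)} := by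
  ext x
  constructor
  · rintro ⟨y, rfl⟩
    exact y.1.2
  · intro hx
    refine ⟨⟨⟨x, hx⟩, ?_⟩, rfl⟩
    rintro _ ⟨-, K, hK, rfl⟩ h
    exact x.2 K hK h

/-- The tube is built from affine equations of the remaining hyperplanes and a vector `v H` on which
the linear part of the equation of `H` is 1. -/
theorem isTube : ∃ N U V W₁ W₂,
    LocalSystem.IsTube (Set.range (A.inclRestriction H)) N U V W₁ W₂ := by
  have := (A.deletion H).finite.fintype
  choose f a v hv hf using fun K : A.hyperplanes => (A.isHyperplane K K.2).exists_eq
  have h := HyperplaneTube.isTube (ι := (A.deletion H).hyperplanes)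
    (f := fun K => f ⟨K, K.2.1⟩) (a := fun K => a ⟨K, K.2.1⟩) (f₀ := f H) (a₀ := a H) (hv H)
    (X := (A.deletion H).complement) (fun x => by
      constructor
      · exact fun hx K hK => hx K K.2 ((hf ⟨K, K.2.1⟩ x).2 hK)
      · exact fun hx K hK hxK => hx ⟨K, hK⟩ ((hf ⟨K, hK.1⟩ x).1 hxK))
  have hZ : {x : (A.deletion H).complement | HyperplaneTube.coord (f H) (a H) x = 0} =
      Set.range (A.inclRestriction H) := by
    rw [range_inclRestriction]
    ext x
    exact sub_eq_zero.trans (hf H x).symm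
  rw [hZ] at h
  exact ⟨_, _, _, _, _, h⟩

theorem compl_range_inclRestriction :
    (Set.range (A.inclRestriction H))ᶜ = Set.range (A.inclDeletion H) := by
  rw [range_inclRestriction, range_inclDeletion]
  rfl

end HyperplaneArrangement

/-! ### Path connectedness of the complement in H -/

namespace HyperplaneArrangement

variable {ℓ : ℕ} (A : HyperplaneArrangement (EuclideanSpace ℂ (Fin ℓ)) (EuclideanSpace ℂ (Fin ℓ)))
  (H : A.hyperplanes)

/-- The complement of the restriction is path connected: a complex line through two of its points
meets the hyperplanes in finitely many points. -/
theorem joined_complement_restriction (x y : (A.restriction H).complement) : Joined x y := by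
  let g : ℂ → (H : AffineSubspace ℂ (EuclideanSpace ℂ (Fin ℓ))) := fun t =>
    ⟨AffineMap.lineMap x.1.1 y.1.1 t, AffineMap.lineMap_mem t x.1.2 y.1.2⟩
  have hg : Continuous g :=
    Continuous.subtype_mk (AffineMap.lineMap_continuous (R := ℂ) (p := x.1.1) (q := y.1.1)) _
  have hg0 : g 0 = x.1 := Subtype.ext (AffineMap.lineMap_apply_zero _ _)
  have hg1 : g 1 = y.1 := Subtype.ext (AffineMap.lineMap_apply_one _ _)
  -- Each hyperplane contributes at most one parameter: the equation along the line is affine in `t`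
  -- and does not vanish at `x`.
  let B : Set ℂ := ⋃ T ∈ (A.restriction H).hyperplanes, {t | g t ∈ T}
  have hB : B.Countable := by
    refine (A.restriction H).finite.countable.biUnion fun T hT => Set.Subsingleton.countable ?_
    have hxT := x.2 T hT
    obtain ⟨-, K, hK, rfl⟩ := hT
    obtain ⟨f, a, -, -, hf⟩ := (A.isHyperplane K hK.1).exists_eq
    have hx : f x.1.1 ≠ a := fun h => hxT ((hf _).2 h)
    have key : ∀ t, g t ∈ K.comap (H : AffineSubspace ℂ _).subtype →
        f x.1.1 - a = -(t * (f y.1.1 - f x.1.1)) := by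
      intro t ht
      have h : f (AffineMap.lineMap x.1.1 y.1.1 t) = a := (hf _).1 ht
      rw [AffineMap.lineMap_apply, vadd_eq_add, vsub_eq_sub, map_add, map_smul, map_sub,
        smul_eq_mul] at h
      linear_combination h
    intro s hs t ht
    have h1 := key s hs
    have h2 := key t ht
    have h3 : f y.1.1 - f x.1.1 ≠ 0 := by
      intro h
      rw [h, mul_zero, neg_zero, sub_eq_zero] at h1
      exact hx h1
    exact mul_right_cancel₀ h3 (neg_injective (h1.symm.trans h2))
  have hmem : ∀ t, t ∈ Bᶜ ↔ g t ∈ (A.restriction H).complement := by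
    intro t
    simp only [B, Set.mem_compl_iff, Set.mem_iUnion, not_exists]
    rfl
  -- The parameter line has real dimension two, so removing a countable set leaves it path
  -- connected.
  have hpc := hB.isPathConnected_compl_of_one_lt_rank
    (by rw [Complex.rank_real_complex]; exact Cardinal.one_lt_two)
  obtain ⟨γ, hγ⟩ := hpc.joinedIn 0 ((hmem 0).2 (by rw [hg0]; exact x.2)) 1
    ((hmem 1).2 (by rw [hg1]; exact y.2))
  exact ⟨{ toFun := fun t => ⟨g (γ t), (hmem _).1 (hγ t)⟩
           continuous_toFun := Continuous.subtype_mk (hg.comp γ.continuous) _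
           source' := Subtype.ext ((congrArg g γ.source).trans hg0)
           target' := Subtype.ext ((congrArg g γ.target).trans hg1) }⟩

end HyperplaneArrangement

end

/-! ### The theorem -/

open CategoryTheory CategoryTheory.Limits in
theorem corollary2p3 (ℓ : ℕ)
    (A : HyperplaneArrangement (EuclideanSpace ℂ (Fin ℓ)) (EuclideanSpace ℂ (Fin ℓ)))
    (H : A.hyperplanes)
    (L' : LocalSystem (A.deletion H).complement) (hL' : L'.IsRankOne) :
    (∀ q : ℤ,
      IsZero ((L'.pullback (A.inclRestriction H)).cohomology (q - 1)) →
      ¬ IsZero ((L'.pullback (A.inclDeletion H)).cohomology q) →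
      ¬ IsZero (L'.cohomology q)) ∧
    (¬ (L'.pullback (A.inclRestriction H)).IsTrivial →
      IsIso (L'.restriction (A.inclDeletion H) 1)) := by
  obtain ⟨N, U, V, W₁, W₂, h⟩ := A.isTube H
  have hi := A.isEmbedding_inclDeletion H
  have hj := A.isEmbedding_inclRestriction H
  have hM := A.compl_range_inclRestriction H
  refine ⟨fun q hq hne hzero => ?_, fun hnt => ?_⟩
  · cases q with
    -- In negative degrees both cohomology modules are the same zero module.
    | negSucc n => exact hne hzero
    | ofNat n =>
      refine hne ((LocalSystem.isZero_cohomology_pullback_iff L' hi n).2 fun c hc => ?_)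
      rw [← hM] at hc ⊢
      -- The vanishing of H^{q-1}(M'') is used only for q = m + 1; for q = 0 the condition on the
      -- core is empty.
      obtain ⟨c', hc', hcc'⟩ := h.exists_cocyc_univ (fun m hm => by
        subst hm
        rw [← LocalSystem.isZero_cohomology_pullback_iff L' hj m]
        have : Int.ofNat (m + 1) - 1 = (m : ℤ) := by
          simp
        rwa [this] at hq) hc
      have h1 := (LocalSystem.isZero_cohomology_iff L' n).1 hzero hc'
      have := Submodule.sub_mem _ (LocalSystem.cob_anti (Set.subset_univ _) n h1) hcc'
      rwa [sub_sub_cancel] at this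
  · have hZ : L'.cocyc 0 (Set.range (A.inclRestriction H)) ≤
        L'.cob (Set.range (A.inclRestriction H)) 0 := by
      rw [← LocalSystem.isZero_cohomology_pullback_iff L' hj, LocalSystem.isZero_cohomology_iff]
      exact LocalSystem.cocyc_zero_le_cob (A.joined_complement_restriction H)
        (fun x => hL' _) hnt
    have hmono := LocalSystem.mono_restriction L' hi 1 fun c hc hcM =>
      h.mem_cob_univ hc (hM ▸ hcM)
    have hepi := LocalSystem.epi_restriction L' hi 1 fun c hc => by
      rw [← hM] at hc ⊢
      refine h.exists_cocyc_univ (fun m hm => ?_) hc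
      obtain rfl : m = 0 := by omega
      exact hZ
    exact isIso_of_mono_of_epi
      (HomologicalComplex.homologyMap (LocalSystem.cochainRestriction (A.inclDeletion H) L') 1)
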